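/- **Weak solenoids and germinal holonomy.** A presentation is a sequence of finite coverings $p_{\ell+1}\colon M_{\ell+1}\to M_\ell$ ($\ell\ge 0$) of constant degree $>1$ between compact connected manifolds without boundary of a fixed dimension $n\ge 1$; its inverse limit $\varprojlim M_\ell$ is a weak solenoid, whose leaves are its path components. Let $S$ be a space. A transverse section $V_0$ of $S$ is given by a homeomorphism $S\cong\varprojlim M_\ell$ for some presentation and a point $x_0\in M_0$: it is the fibre over $x_0$ of the resulting projection $S\to M_0$. The group $G_0=\pi_1(M_0,x_0)$ acts on $V_0$ by the global holonomy $\Phi_0$: $\Phi_0(g)(y)$ is the end point of the lift to $S$, starting at $y$, of a loop representing $g$. For $x\in V_0$ let $K_x=\{g\in G_0:\Phi_0(g)(x)=x\}$, and let $\mathrm{Germ}(\Phi_0,x)$ be the quotient of $K_x$ that identifies $g_1,g_2$ whenever $\Phi_0(g_1)$ and $\Phi_0(g_2)$ agree on some open neighbourhood of $x$ in $V_0$. The germinal holonomy at $x$ is trivial if $\mathrm{Germ}(\Phi_0,x)$ is trivial; it is locally trivial if there is a single open neighbourhood $U\subset V_0$ of $x$ on which every $\Phi_0(g)$, $g\in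 K_x$, is the identity. **The Schori solenoid.** Let $X_0$ be the closed orientable surface of genus $2$ obtained from a sphere with four holes by gluing the boundary circles in two pairs; the two pairs become the curves $C_0$ and $D_0$. Explicitly, the compact planar domain $1\le|z|\le 20$, $|z-6|\ge 1$, $|z+6|\ge 1$ is glued by $z\sim 20z$ for $|z|=1$ and by $z\sim w$ for $|z-6|=1$, $(z-6)(w+6)=1$. Fix a base point $x_0$ off these curves, a longitude $\alpha$ through $x_0$ crossing $C_0$ once and not meeting $D_0$, and a longitude $\beta$ through $x_0$ crossing $D_0$ once and not meeting $C_0$. Inductively, given the covering $X_\ell\to X_0$ and the base point $x_\ell$, let $C_\ell$ be a component of the preimage of $C_0$ that is crossed by the closed loop through $x_\ell$ covering $\alpha$ (the loop around the handle $H_\ell$), and $D_\ell$ a component of the preimage of $D_0$ that is crossed by the closed loop through $x_\ell$ covering $\beta$ (the loop around the handle $F_\ell$). Cut $X_\ell$ along $C_\ell$ and $D_\ell$, take three copies of the cut surface, numbered $0,1,2$, and reglue: crossing $C_\ell$ in the positive direction exchanges the copies $0$ and $1$ and preserves the copy $2$; crossing $D_\ell$ in the positive direction exchanges the copies $1$ and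 $2$ and preserves the copy $0$. The result is $X_{\ell+1}$, with its obvious map $f_\ell^{\ell+1}\colon X_{\ell+1}\to X_\ell$; let $x_{\ell+1}$ be the point over $x_\ell$ in the copy number $1$. The Schori solenoid is $\mathcal S=\varprojlim X_\ell$. **Theorem.** For every choice of the curves $C_\ell$, $D_\ell$ as above, the following hold. 1. The maps $f_\ell^{\ell+1}\colon X_{\ell+1}\to X_\ell$ form a presentation of a $2$-dimensional weak solenoid; each of them is a $3$-fold covering, and it is not regular: for every $x\in X_{\ell+1}$ the image of $\pi_1(X_{\ell+1},x)$ in $\pi_1(X_\ell,f_\ell^{\ell+1}(x))$ is not a normal subgroup. 2. There is a leaf $L$ of $\mathcal S$ with trivial germinal holonomy: for every transverse section $V_0$ of $\mathcal S$ and every $y\in V_0\cap L$, $\mathrm{Germ}(\Phi_0,y)$ is trivial. 3. For every transverse section $V_0$ of $\mathcal S$ and every point $x\in V_0$, the germinal holonomy $\mathrm{Germ}(\Phi_0,x)$ is not locally trivial. -/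

import Mathlib

universe u v

/-! ### Weak solenoids, transverse sections and germinal holonomy -/

/-- The inverse limit of a sequence of maps `p ℓ : M (ℓ + 1) → M ℓ`, as a subspace of the
product. -/
def InverseLimit (M : ℕ → Type u) (p : ∀ ℓ, M (ℓ + 1) → M ℓ) : Type u :=
  {x : ∀ ℓ, M ℓ // ∀ ℓ, p ℓ (x (ℓ + 1)) = x ℓ}

instance (M : ℕ → Type u) [∀ ℓ, TopologicalSpace (M ℓ)] (p : ∀ ℓ, M (ℓ + 1) → M ℓ) :
    TopologicalSpace (InverseLimit M p) :=
  inferInstanceAs (TopologicalSpace {x : ∀ ℓ, M ℓ // ∀ ℓ, p ℓ (x (ℓ + 1)) = x ℓ})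

/-- A presentation of an `n`-dimensional weak solenoid: every `M ℓ` is a compact connected
`n`-manifold without boundary, and every `p ℓ` is a finite covering of constant degree `> 1`. -/
structure IsPresentation (n : ℕ) (M : ℕ → Type u) [∀ ℓ, TopologicalSpace (M ℓ)]
    (p : ∀ ℓ, M (ℓ + 1) → M ℓ) : Prop where
  dim_pos : 1 ≤ n
  compact : ∀ ℓ, CompactSpace (M ℓ)
  connected : ∀ ℓ, ConnectedSpace (M ℓ)
  hausdorff : ∀ ℓ, T2Space (M ℓ)
  manifold : ∀ ℓ, Nonempty (ChartedSpace (EuclideanSpace ℝ (Fin n)) (M ℓ))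
  covering : ∀ ℓ, IsCoveringMap (p ℓ)
  degree : ∀ ℓ, ∃ m : ℕ, 1 < m ∧ ∀ y, Nat.card (p ℓ ⁻¹' {y}) = m

/-- A transverse section of a space `S` homeomorphic to a weak solenoid: it is given by a
presentation of `S`, that is, an identification of `S` with a weak solenoid `lim M ℓ`, and a point
`base` of `M 0`. The section itself is the fibre (`carrier`) of the bundle projection `S → M 0` over
`base`. The presentation is arbitrary, it need not be one by which `S` was constructed; for instance
the presentations obtained from a given one by forgetting the first `n` terms yield as sections
the cylinder sets of its fibres. -/
structure TransverseSection (S : Type v) [TopologicalSpace S] where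
  dim : ℕ
  M : ℕ → Type u
  [top : ∀ ℓ, TopologicalSpace (M ℓ)]
  bond : ∀ ℓ, M (ℓ + 1) → M ℓ
  isPresentation : IsPresentation dim M bond
  homeo : S ≃ₜ InverseLimit M bond
  base : M 0

attribute [instance] TransverseSection.top

namespace TransverseSection

variable {S : Type v} [TopologicalSpace S] (V : TransverseSection.{u} S)

/-- The bundle projection `S → M 0`. -/
def proj (s : S) : V.M 0 := (V.homeo s).1 0

/-- The points of the section. -/
def carrier : Set S := {s | V.proj s = V.base}

/-- The group acting on the section, `π₁(M 0, base)`. -/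
abbrev Grp : Type u := FundamentalGroup (V.M 0) V.base

/-- The graph of the global holonomy map of `g`: `V.Holonomy g y z` says that `h_g(y) = z`, i.e.
that the lift to `S`, starting at `y`, of a loop representing `g` ends at `z`. -/
def Holonomy (g : V.Grp) (y z : V.carrier) : Prop :=
  ∃ γ : Path V.base V.base, FundamentalGroup.fromPath (Path.Homotopic.Quotient.mk γ) = g ∧
    ∃ Γ : C(unitInterval, S), (∀ t, V.proj (Γ t) = γ t) ∧ Γ 0 = y ∧ Γ 1 = z

/-- The isotropy group at `x` of the global holonomy action (as a set). -/
def isotropy (x : V.carrier) : Set V.Grp := {g | V.Holonomy g x x}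

/-- `g₁` and `g₂` have the same germinal holonomy at `x`: the restrictions of `h_{g₁}` and
`h_{g₂}` to some open neighbourhood of `x` in the section agree. -/
def germSetoid (x : V.carrier) : Setoid (V.isotropy x) where
  r g₁ g₂ := ∃ U : Set V.carrier, IsOpen U ∧ x ∈ U ∧
    ∀ y ∈ U, ∀ z, V.Holonomy g₁ y z ↔ V.Holonomy g₂ y z
  iseqv :=
    { refl := fun _ => ⟨Set.univ, isOpen_univ, trivial, fun _ _ _ => Iff.rfl⟩
      symm := fun ⟨U, hU, hx, h⟩ => ⟨U, hU, hx, fun y hy z => (h y hy z).symm⟩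
      trans := fun ⟨U, hU, hx, h⟩ ⟨W, hW, hx', h'⟩ => ⟨U ∩ W, hU.inter hW, ⟨hx, hx'⟩,
        fun y hy z => (h y hy.1 z).trans (h' y hy.2 z)⟩ }

/-- The set underlying the germinal holonomy group at `x`. -/
def Germ (x : V.carrier) : Type u := Quotient (V.germSetoid x)

/-- The germinal holonomy at `x` is trivial. -/
def GermTrivial (x : V.carrier) : Prop := Subsingleton (V.Germ x)

/-- The germinal holonomy at `x` is locally trivial: one open neighbourhood of `x` in the section is
fixed pointwise by all elements of the isotropy group of `x`. -/
def GermLocallyTrivial (x : V.carrier) : Prop :=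
  ∃ U : Set V.carrier, IsOpen U ∧ x ∈ U ∧ ∀ g ∈ V.isotropy x, ∀ y ∈ U, V.Holonomy g y y

end TransverseSection

/-! ### The Schori solenoid -/

namespace Schori

/-- An open sphere with four holes: the plane annulus `1/2 < |z| < 40` without the two closed
discs of radius `1/2` around `6` and `-6`. It is the genus two surface cut open along the two curves
`C₀` and `D₀`, thickened by collars: cutting along the core curves of the collars would
give the compact domain `1 ≤ |z| ≤ 20`, `1 ≤ |z - 6|`, `1 ≤ |z + 6|`. -/
def Piece : Type :=
  {z : ℂ // 1 / 2 < ‖z‖ ∧ ‖z‖ < 40 ∧ 1 / 2 < ‖z - 6‖ ∧ 1 / 2 < ‖z + 6‖}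

instance : TopologicalSpace Piece := inferInstanceAs (TopologicalSpace (Subtype _))

/-- The pieces of which the surface `X_ℓ` consists are indexed by words of length `ℓ` in three
letters: `X_{ℓ+1}` is made of three copies of (the cut surface) `X_ℓ`, numbered `0, 1, 2`, and the
piece `(v, i)` of `X_{ℓ+1}` is the copy of the piece `v` of `X_ℓ` in the copy number `i`. -/
def Sheet : ℕ → Type
  | 0 => Unit
  | ℓ + 1 => Sheet ℓ × Fin 3

instance (ℓ : ℕ) : TopologicalSpace (Sheet ℓ) := ⊥

instance (ℓ : ℕ) : DiscreteTopology (Sheet ℓ) := ⟨rfl⟩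

/-- The piece containing the base point `x_ℓ`: `x_{ℓ+1}` lies in the second copy over `x_ℓ`. -/
def baseSheet : ∀ ℓ, Sheet ℓ
  | 0 => ()
  | ℓ + 1 => (baseSheet ℓ, 1)

open Classical in
/-- Cutting along a curve and regluing. Let `c ℓ` be the piece from which the curve along which
`X_ℓ` is cut is crossed. When crossing a curve from the piece `(v, i)` of `X_{ℓ+1}`, one
arrives in the piece lying over the one reached from `v` in `X_ℓ`; one stays in the copy
number `i` unless the curve crossed is the cut one (`v = c ℓ`), where one passes to the
copy number `τ i`. -/
noncomputable def regluing (τ : Equiv.Perm (Fin 3)) (c : ∀ ℓ, Sheet ℓ) :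
    ∀ ℓ, Equiv.Perm (Sheet ℓ)
  | 0 => 1
  | ℓ + 1 => Equiv.prodShear (regluing τ c ℓ) (fun v => if v = c ℓ then τ else 1)

/-- A choice of the curves along which the surfaces are cut. The curve `C_ℓ` is
one of the curves in `X_ℓ` that lie over `C₀` and that are crossed by the long loop around the
handle `H_ℓ`, which is the lift through `x_ℓ` of (a power of) the longitude crossing `C₀`.
Likewise for `D_ℓ` and the handle `F_ℓ`. The curves are recorded by the pieces from which they are
crossed. At the copies `0, 1, 2`, the two sides of the cut `C_ℓ` are reglued by exchanging
`0` and `1`, those of `D_ℓ` by exchanging `1` and `2`. -/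
structure Cuts where
  C : ∀ ℓ, Sheet ℓ
  D : ∀ ℓ, Sheet ℓ
  C_mem : ∀ ℓ, (regluing (Equiv.swap 0 1) C ℓ).SameCycle (baseSheet ℓ) (C ℓ)
  D_mem : ∀ ℓ, (regluing (Equiv.swap 1 2) D ℓ).SameCycle (baseSheet ℓ) (D ℓ)

/-- Gluing of the pieces indexed by `I`: the collar `1/2 < |z| < 2` of the piece `v` is glued to the
collar `10 < |w| < 40` of the piece `a v` by `w = 20 z`, and the collar `1/2 < |z - 6| < 2` of
the piece `v` to the collar `1/2 < |w + 6| < 2` of the piece `b v` by `(z - 6) (w + 6) = 1`.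
(The bounds hold automatically for points of the pieces.) -/
inductive Glue {I : Type} (a b : Equiv.Perm I) : I × Piece → I × Piece → Prop
  | crossC (v : I) (z w : Piece) (h : w.1 = 20 * z.1) : Glue a b (v, z) (a v, w)
  | crossD (v : I) (z w : Piece) (h : (z.1 - 6) * (w.1 + 6) = 1) : Glue a b (v, z) (b v, w)

/-- The closed surface `X_ℓ`. -/
def Surface (κ : Cuts) (ℓ : ℕ) : Type :=
  Quot (Glue (regluing (Equiv.swap 0 1) κ.C ℓ) (regluing (Equiv.swap 1 2) κ.D ℓ))

instance (κ : Cuts) (ℓ : ℕ) : TopologicalSpace (Surface κ ℓ) :=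
  inferInstanceAs (TopologicalSpace (Quot _))

/-- The covering `X_{ℓ+1} → X_ℓ`, which forgets the number of the copy. -/
def bond (κ : Cuts) (ℓ : ℕ) : Surface κ (ℓ + 1) → Surface κ ℓ :=
  Quot.map (fun q : Sheet (ℓ + 1) × Piece => ((q.1.1, q.2) : Sheet ℓ × Piece)) (by
    rintro _ _ (⟨v, z, w, h⟩ | ⟨v, z, w, h⟩)
    · exact Glue.crossC v.1 z w h
    · exact Glue.crossD v.1 z w h)

theorem continuous_bond (κ : Cuts) (ℓ : ℕ) : Continuous (bond κ ℓ) := by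
  refine continuous_quot_lift _ (continuous_quot_mk.comp ?_)
  exact ((continuous_of_discreteTopology (f := fun v : Sheet (ℓ + 1) => v.1)).comp
    continuous_fst).prodMk continuous_snd

/-- The Schori solenoid. -/
abbrev Solenoid (κ : Cuts) : Type := InverseLimit (Surface κ) (bond κ)

end Schori

/-! Along a path in the solenoid, the crossings of the lifts of `C₀` and `D₀` spell a word in the
free group on two letters. This group acts on `Ends`, the compatible sequences of pieces, and the
holonomy of the defining presentation factors through that action (`exists_endWord_of_path`,
`exists_path_of_endWord`). The theorem thus becomes a statement about words.

Going around the handle `H_ℓ` is a power of the first letter. Its cycle of pieces meets the cut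
`C_ℓ` exactly once, so this power permutes the three copies of the base piece by (0 1); going around
`F_ℓ` gives (1 2). All later cuts over `C₀` lie on the cycle of the base piece, which is taken in
copy 1. Copy 2 lies on another cycle, never cut again, so the power fixes every end through copy 2.
In the same way the word for `F_ℓ` fixes every end through copy 0 (`exists_word_C`,
`exists_word_D`).

The two transpositions generate the symmetric group on three letters, whose point stabilizers are
not normal: the coverings are not regular. Conjugating the same words, one finds arbitrarily close
to any end another end moved by a word that fixes the given one (`exists_word_fixing_moving`): no
germinal holonomy is locally trivial. Finally, the free group is countable and each word has a
closed fixed set with nowhere dense frontier; by Baire some end avoids all these frontiers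
(`exists_generic_end`). Conjugation spreads this property over its leaf, which has trivial germinal
holonomy.

Arbitrary presentations are reduced to the defining one by `exists_nhds_loopLifts`: lifts of a loop
through nearby points stay uniformly close to it, hence can be pushed along leaves into lifts for
another presentation. -/

namespace InverseLimit

open Topology unitInterval

/-! ### Path and homotopy lifting to an inverse limit of coverings. -/

theorem level_eq_of_le {M : ℕ → Type u} {p : ∀ ℓ, M (ℓ + 1) → M ℓ} {x y : InverseLimit M p}
    {m n : ℕ} (hmn : m ≤ n) (h : x.1 n = y.1 n) :
    x.1 m = y.1 m := by
  induction n, hmn using Nat.le_induction with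
  | base => exact h
  | succ k _ ih => exact ih (by rw [← x.2 k, ← y.2 k, h])

variable {M : ℕ → Type u} [∀ ℓ, TopologicalSpace (M ℓ)] {p : ∀ ℓ, M (ℓ + 1) → M ℓ}

theorem continuous_level (n : ℕ) : Continuous fun x : InverseLimit M p => x.1 n :=
  (continuous_apply n).comp continuous_subtype_val

theorem continuous_iff_level {A : Type*} [TopologicalSpace A] {f : A → InverseLimit M p} :
    Continuous f ↔ ∀ n, Continuous fun a => (f a).1 n := by
  refine ⟨fun h n => (continuous_level n).comp h, fun h => ?_⟩
  exact Continuous.subtype_mk (continuous_pi h) fun a => (f a).2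

/-- Unique lifting holds one level at a time. Hence lifts that are close at one point, in the sense
of agreeing at level `n`, remain so everywhere. -/
theorem level_eq_of_lift (hp : ∀ ℓ, IsCoveringMap (p ℓ)) {A : Type*} [TopologicalSpace A]
    [PreconnectedSpace A] {f g : A → InverseLimit M p} (hf : Continuous f) (hg : Continuous g)
    (h0 : ∀ a, (f a).1 0 = (g a).1 0) (n : ℕ) (a₀ : A) (h : (f a₀).1 n = (g a₀).1 n) (a : A) :
    (f a).1 n = (g a).1 n := by
  induction n generalizing a with
  | zero => exact h0 a
  | succ n ih =>
    have key := (hp n).eq_of_comp_eq (g₁ := fun a => (f a).1 (n + 1))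
      (g₂ := fun a => (g a).1 (n + 1)) ((continuous_level _).comp hf) ((continuous_level _).comp hg)
      (funext fun a => by
        simp only [Function.comp_apply, (f a).2 n, (g a).2 n]
        exact ih (level_eq_of_le n.le_succ h) a) a₀ h
    exact congr_fun key a

theorem eq_of_lift (hp : ∀ ℓ, IsCoveringMap (p ℓ)) {A : Type*} [TopologicalSpace A]
    [PreconnectedSpace A] {f g : A → InverseLimit M p} (hf : Continuous f) (hg : Continuous g)
    (h0 : ∀ a, (f a).1 0 = (g a).1 0) (a₀ : A) (h : f a₀ = g a₀) : f = g :=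
  funext fun a => Subtype.ext <| funext fun n =>
    level_eq_of_lift hp hf hg h0 n a₀ (by rw [h]) a

theorem exists_homotopy_lift (hp : ∀ ℓ, IsCoveringMap (p ℓ)) {A : Type*} [TopologicalSpace A]
    (H : C(I × A, M 0)) (f : C(A, InverseLimit M p)) (H0 : ∀ a, H (0, a) = (f a).1 0) :
    ∃ H' : C(I × A, InverseLimit M p), (∀ x, (H' x).1 0 = H x) ∧ ∀ a, H' (0, a) = f a := by
  let F : ∀ n, C(A, M n) := fun n => ⟨fun a => (f a).1 n, (continuous_level n).comp f.2⟩
  -- The lift is built level by level; prescribing its initial values by `f` at each level makes the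
  -- next lift possible.
  let G : ∀ n, {g : C(I × A, M n) // ∀ a, g (0, a) = F n a} := fun n =>
    Nat.rec ⟨H, H0⟩ (fun n g =>
      ⟨(hp n).liftHomotopy g.1 (F (n + 1)) (fun a => by rw [g.2 a]; exact ((f a).2 n).symm),
        fun a => (hp n).liftHomotopy_zero _ _ _ a⟩) n
  have hG : ∀ n x, p n ((G (n + 1)).1 x) = (G n).1 x := fun n x =>
    congr_fun ((hp n).liftHomotopy_lifts (G n).1 (F (n + 1))
      (fun a => by rw [(G n).2 a]; exact ((f a).2 n).symm)) x
  refine ⟨⟨fun x => ⟨fun n => (G n).1 x, fun n => hG n x⟩, ?_⟩, fun x => rfl, fun a => ?_⟩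
  · exact continuous_iff_level.2 fun n => (G n).1.2
  · exact Subtype.ext (funext fun n => (G n).2 a)

theorem compactSpace (hc : ∀ ℓ, CompactSpace (M ℓ)) (hT : ∀ ℓ, T2Space (M ℓ))
    (hp : ∀ ℓ, Continuous (p ℓ)) : CompactSpace (InverseLimit M p) := by
  have : IsClosed {x : ∀ ℓ, M ℓ | ∀ ℓ, p ℓ (x (ℓ + 1)) = x ℓ} := by
    rw [Set.ofPred_forall]
    exact isClosed_iInter fun ℓ =>
      isClosed_eq ((hp ℓ).comp (continuous_apply _)) (continuous_apply _)
  exact isCompact_iff_compactSpace.1 this.isCompact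

theorem t2Space (hT : ∀ ℓ, T2Space (M ℓ)) : T2Space (InverseLimit M p) :=
  inferInstanceAs (T2Space {x : ∀ ℓ, M ℓ // ∀ ℓ, p ℓ (x (ℓ + 1)) = x ℓ})

/-- Points of the fibre near `x` cannot be told from `x` at a finite level. -/
theorem exists_nhds_level_eq (hp : ∀ ℓ, IsCoveringMap (p ℓ)) (x : InverseLimit M p) (n : ℕ) :
    ∃ D ∈ 𝓝 x, ∀ b ∈ D, b.1 0 = x.1 0 → b.1 n = x.1 n := by
  induction n with
  | zero => exact ⟨_, Filter.univ_mem, fun b _ h => h⟩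
  | succ n ih =>
    obtain ⟨D, hD, h⟩ := ih
    obtain ⟨e, he, hpe⟩ := (hp n).isLocalHomeomorph (x.1 (n + 1))
    refine ⟨_, Filter.inter_mem hD ((continuous_level (n + 1)).continuousAt.preimage_mem_nhds
      (e.open_source.mem_nhds he)), fun b hb h0 => e.injOn hb.2 he ?_⟩
    rw [← hpe, b.2, x.2, h b hb.1 h0]

/-- If every cylinder left the neighbourhood, compactness would give a point agreeing with `x` at
all levels, yet outside its interior. -/
theorem exists_cylinder_subset (hc : ∀ ℓ, CompactSpace (M ℓ)) (hT : ∀ ℓ, T2Space (M ℓ))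
    (hp : ∀ ℓ, Continuous (p ℓ)) {x : InverseLimit M p} {O : Set (InverseLimit M p)}
    (hO : O ∈ 𝓝 x) : ∃ n, ∀ y : InverseLimit M p, y.1 n = x.1 n → y ∈ O := by
  have := compactSpace hc hT hp
  by_contra! h
  let K : ℕ → Set (InverseLimit M p) := fun n => {y | y.1 n = x.1 n} ∩ (interior O)ᶜ
  have hK : ∀ n, IsClosed (K n) := fun n =>
    (isClosed_eq (continuous_level n) continuous_const).inter isOpen_interior.isClosed_compl
  obtain ⟨y, hy⟩ := IsCompact.nonempty_iInter_of_sequence_nonempty_isCompact_isClosed K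
    (fun n y hy => ⟨level_eq_of_le n.le_succ hy.1, hy.2⟩)
    (fun n => by
      obtain ⟨y, h1, h2⟩ := h n
      exact ⟨y, h1, fun h3 => h2 (interior_subset h3)⟩) (hK 0).isCompact hK
  rw [Set.mem_iInter] at hy
  have e : y = x := Subtype.ext (funext fun n => (hy n).1)
  exact (hy 0).2 (e ▸ mem_interior_iff_mem_nhds.2 hO)

end InverseLimit

/-! ### Lifting and uniform closeness for a transverse section. -/

namespace TransverseSection

open Topology unitInterval

variable {S : Type v} [TopologicalSpace S] (V : TransverseSection.{u} S)

/-- The projection of `S` to the `n`-th space of the presentation. -/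
def level (n : ℕ) (s : S) : V.M n := (V.homeo s).1 n

theorem continuous_level (n : ℕ) : Continuous (V.level n) :=
  (InverseLimit.continuous_level n).comp V.homeo.continuous

theorem continuous_proj : Continuous V.proj := V.continuous_level 0

theorem level_eq_of_lift {A : Type*} [TopologicalSpace A]
    [PreconnectedSpace A] {f g : A → S} (hf : Continuous f) (hg : Continuous g)
    (h0 : ∀ a, V.proj (f a) = V.proj (g a)) (n : ℕ) (a₀ : A)
    (h : V.level n (f a₀) = V.level n (g a₀)) (a : A) :
    V.level n (f a) = V.level n (g a) :=
  InverseLimit.level_eq_of_lift V.isPresentation.covering (V.homeo.continuous.comp hf)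
    (V.homeo.continuous.comp hg) h0 n a₀ h a

theorem eq_of_lift {A : Type*} [TopologicalSpace A]
    [PreconnectedSpace A] {f g : A → S} (hf : Continuous f) (hg : Continuous g)
    (h0 : ∀ a, V.proj (f a) = V.proj (g a)) (a₀ : A) (h : f a₀ = g a₀) : f = g := by
  have := InverseLimit.eq_of_lift V.isPresentation.covering (V.homeo.continuous.comp hf)
    (V.homeo.continuous.comp hg) h0 a₀ (congrArg V.homeo h)
  exact funext fun a => V.homeo.injective (congr_fun this a)

theorem eq_of_lift_on {A : Type*} [TopologicalSpace A] {C : Set A} (hC : IsPreconnected C)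
    {f g : A → S} (hf : ContinuousOn f C) (hg : ContinuousOn g C)
    (h0 : ∀ a ∈ C, V.proj (f a) = V.proj (g a)) {a₀ a : A} (ha₀ : a₀ ∈ C) (h : f a₀ = g a₀)
    (ha : a ∈ C) : f a = g a := by
  have := isPreconnected_iff_preconnectedSpace.1 hC
  exact congr_fun (V.eq_of_lift hf.domRestrict hg.domRestrict (fun a => h0 a a.2) ⟨a₀, ha₀⟩ h)
    ⟨a, ha⟩

theorem exists_homotopy_lift {A : Type*} [TopologicalSpace A]
    (H : C(I × A, V.M 0)) (f : C(A, S)) (H0 : ∀ a, H (0, a) = V.proj (f a)) :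
    ∃ H' : C(I × A, S), (∀ x, V.proj (H' x) = H x) ∧ ∀ a, H' (0, a) = f a := by
  obtain ⟨H', h, h'⟩ := InverseLimit.exists_homotopy_lift V.isPresentation.covering H
    ⟨fun a => V.homeo (f a), V.homeo.continuous.comp f.continuous⟩ H0
  refine ⟨⟨fun x => V.homeo.symm (H' x), V.homeo.symm.continuous.comp H'.continuous⟩,
    fun x => ?_, fun a => ?_⟩
  · rw [← h x]; simp [proj]
  · exact (congrArg V.homeo.symm (h' a)).trans (V.homeo.symm_apply_apply _)

theorem exists_path_lift (γ : C(I, V.M 0)) (y : S) (h : γ 0 = V.proj y) :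
    ∃ Γ : C(I, S), (∀ t, V.proj (Γ t) = γ t) ∧ Γ 0 = y := by
  obtain ⟨H, h1, h2⟩ := V.exists_homotopy_lift (A := Unit) (γ.comp ContinuousMap.fst)
    (.const _ y) (fun _ => h)
  exact ⟨H.comp ((ContinuousMap.id I).prodMk (.const I ())), fun t => h1 _, h2 ()⟩

/-- The end points of the lifted homotopy form a lift of a constant path, so they do not move. Thus
the holonomy depends only on the homotopy class of the loop. -/
theorem lift_end_eq_of_homotopic {b c : V.M 0} {γ₁ γ₂ : Path b c} (h : γ₁.Homotopic γ₂)
    {Γ₁ Γ₂ : C(I, S)} (h₁ : ∀ t, V.proj (Γ₁ t) = γ₁ t) (h₂ : ∀ t, V.proj (Γ₂ t) = γ₂ t)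
    (h0 : Γ₁ 0 = Γ₂ 0) : Γ₁ 1 = Γ₂ 1 := by
  obtain ⟨F⟩ := h
  obtain ⟨H, hH, H0⟩ := V.exists_homotopy_lift
    (A := I) (F.toContinuousMap.comp ContinuousMap.prodSwap) (.const I (Γ₁ 0)) (by
      intro s
      rw [ContinuousMap.const_apply, h₁]
      simp)
  have e : ∀ (s : I) (Γ : C(I, S)), (∀ t, V.proj (Γ t) = F (s, t)) → Γ 0 = Γ₁ 0 →
      Γ 1 = H (1, s) := fun s Γ hΓ hΓ0 => congr_fun (V.eq_of_lift (f := Γ) (g := fun t => H (t, s))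
    Γ.continuous (by fun_prop) (fun t => by rw [hΓ, hH]; rfl) 0 (by rw [hΓ0, H0]; rfl)) 1
  have e' := V.eq_of_lift (f := fun s => H (1, s)) (g := fun _ => H (1, 0)) (by fun_prop)
    (by fun_prop) (fun s => by
      rw [hH, hH]
      simp) 0 rfl
  rw [e 0 Γ₁ (by simpa using h₁) rfl, e 1 Γ₂ (by simpa using h₂) h0.symm]
  exact (congr_fun e' 1).symm

include V in
theorem compactSpace : CompactSpace S := by
  have h := V.isPresentation
  have := InverseLimit.compactSpace h.compact h.hausdorff fun ℓ => (h.covering ℓ).continuous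
  exact V.homeo.symm.compactSpace

include V in
theorem t2Space : T2Space S := by
  have := InverseLimit.t2Space (p := V.bond) V.isPresentation.hausdorff
  exact V.homeo.symm.t2Space

theorem exists_nhds_level_eq (x : S) (n : ℕ) :
    ∃ D ∈ 𝓝 x, ∀ b ∈ D, V.proj b = V.proj x → V.level n b = V.level n x := by
  obtain ⟨D, hD, h⟩ := InverseLimit.exists_nhds_level_eq V.isPresentation.covering (V.homeo x) n
  exact ⟨_, V.homeo.continuous.continuousAt.preimage_mem_nhds hD, fun b hb => h _ hb⟩

/-- Points with the same projection to a high level are uniformly close. -/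
theorem exists_level_mem {O : Set (S × S)} (hO : IsOpen O) (hd : ∀ a, (a, a) ∈ O) :
    ∃ n, ∀ a b, V.level n a = V.level n b → (a, b) ∈ O := by
  have := V.compactSpace
  have := V.isPresentation.hausdorff
  by_contra! h
  let K : ℕ → Set (S × S) := fun n => {x | V.level n x.1 = V.level n x.2} ∩ Oᶜ
  have hc : ∀ n, IsClosed (K n) := fun n =>
    (isClosed_eq ((V.continuous_level n).comp continuous_fst)
      ((V.continuous_level n).comp continuous_snd)).inter hO.isClosed_compl
  obtain ⟨⟨a, b⟩, hab⟩ := IsCompact.nonempty_iInter_of_sequence_nonempty_isCompact_isClosed K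
    (fun n x hx => ⟨InverseLimit.level_eq_of_le n.le_succ hx.1, hx.2⟩)
    (fun n => by obtain ⟨a, b, h1, h2⟩ := h n; exact ⟨(a, b), h1, h2⟩) (hc 0).isCompact hc
  rw [Set.mem_iInter] at hab
  have e : a = b := V.homeo.injective (Subtype.ext (funext fun n => (hab n).1))
  exact (hab 0).2 (e ▸ hd a)

end TransverseSection

/-! ### Transport along leaves and comparison of two sections. -/

namespace TransverseSection

open Topology unitInterval

variable {S : Type v} [TopologicalSpace S] (V : TransverseSection.{u} S)

/-- `T` transports points `a` of `S` along leaves to points over `v`, for `v` in `U`. -/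
structure IsTransport (W : Set (S × V.M 0)) (T : S × V.M 0 → S) : Prop where
  cont : ContinuousOn T W
  proj_apply : ∀ x ∈ W, V.proj (T x) = x.2
  apply_proj : ∀ a, (a, V.proj a) ∈ W → T (a, V.proj a) = a

/-- Over a ball in a chart, the straight segment from `V.proj a` to `v` is lifted starting at `a`;
the transported point is the end of this lift. -/
theorem exists_local_transport (b : V.M 0) : ∃ U : Set (V.M 0), IsOpen U ∧ b ∈ U ∧
    ∃ T, V.IsTransport {x | V.proj x.1 ∈ U ∧ x.2 ∈ U} T := by
  classical
  obtain ⟨_⟩ := V.isPresentation.manifold 0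
  let e := chartAt (EuclideanSpace ℝ (Fin V.dim)) b
  have hb : b ∈ e.source := mem_chart_source _ b
  obtain ⟨r, hr, hball⟩ := Metric.isOpen_iff.1 e.open_target (e b) (e.map_source hb)
  let U := e.source ∩ e ⁻¹' Metric.ball (e b) r
  have hU : IsOpen U := e.isOpen_inter_preimage Metric.isOpen_ball
  let W : Set (S × V.M 0) := {x | V.proj x.1 ∈ U ∧ x.2 ∈ U}
  have hcU : ContinuousOn e U := e.continuousOn.mono Set.inter_subset_left
  let h : I × W → EuclideanSpace ℝ (Fin V.dim) := fun y =>
    AffineMap.lineMap (e (V.proj y.2.1.1)) (e y.2.1.2) (y.1 : ℝ)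
  have hh : Continuous h := by
    have h1 : Continuous fun y : I × W => e (V.proj y.2.1.1) :=
      hcU.comp_continuous (V.continuous_proj.comp (by fun_prop)) fun y => y.2.2.1
    have h2 : Continuous fun y : I × W => e y.2.1.2 :=
      hcU.comp_continuous (by fun_prop) fun y => y.2.2.2
    simp only [h, AffineMap.lineMap_apply_module]
    exact ((by fun_prop : Continuous fun y : I × W => 1 - (y.1 : ℝ)).smul h1).add
      ((by fun_prop : Continuous fun y : I × W => (y.1 : ℝ)).smul h2)
  have hmem : ∀ y, h y ∈ Metric.ball (e b) r := fun y =>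
    (convex_ball (e b) r).lineMap_mem y.2.2.1.2 y.2.2.2.2 y.1.2
  let H : C(I × W, V.M 0) := ⟨fun y => e.symm (h y),
    e.continuousOn_symm.comp_continuous hh fun y => hball (hmem y)⟩
  obtain ⟨H', hH', hH0⟩ := V.exists_homotopy_lift H ⟨fun x : W => x.1.1, by fun_prop⟩ (by
    intro x
    simp only [H, h, ContinuousMap.coe_mk, Set.Icc.coe_zero, AffineMap.lineMap_apply_zero]
    exact e.left_inv x.2.1.1)
  refine ⟨U, hU, ⟨hb, Metric.mem_ball_self hr⟩,
    fun x => if hx : x ∈ W then H' (1, ⟨x, hx⟩) else x.1, ?_, ?_, ?_⟩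
  · rw [continuousOn_iff_continuous_domRestrict]
    refine (show Continuous fun x : W => H' (1, x) by fun_prop).congr fun x => ?_
    have : x.1 ∈ W := x.2
    simp [Set.domRestrict, this]
  · intro x hx
    rw [dif_pos hx, hH']
    simp only [H, h, ContinuousMap.coe_mk, Set.Icc.coe_one, AffineMap.lineMap_apply_one]
    exact e.left_inv hx.2.1
  · intro a ha
    have ha' : (a, V.proj a) ∈ W := ha
    rw [dif_pos ha']
    -- Here the segment is constant, and so is its lift.
    refine congr_fun (V.eq_of_lift (f := fun t => H' (t, ⟨(a, V.proj a), ha'⟩)) (g := fun _ => a)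
      (by fun_prop) continuous_const (fun t => ?_) 0 (hH0 _)) 1
    rw [hH']
    simp only [H, h, ContinuousMap.coe_mk, AffineMap.lineMap_same, AffineMap.const_apply]
    exact e.left_inv ha.1.1

theorem locallyConnectedSpace : LocallyConnectedSpace (V.M 0) := by
  obtain ⟨_⟩ := V.isPresentation.manifold 0
  exact ChartedSpace.locallyConnectedSpace (EuclideanSpace ℝ (Fin V.dim)) _

/-- Local transports agree where small connected sets overlap, by unique lifting, so they glue to
one transport between all sufficiently close base points. -/
theorem exists_transport : ∃ W : Set (V.M 0 × V.M 0), IsOpen W ∧ (∀ b, (b, b) ∈ W) ∧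
    ∃ T, V.IsTransport {x | (V.proj x.1, x.2) ∈ W} T := by
  classical
  have := V.isPresentation.compact 0
  have := V.isPresentation.hausdorff 0
  have hlc := V.locallyConnectedSpace
  let _ : UniformSpace (V.M 0) := uniformSpaceOfCompactR1
  choose U hUo hbU T hT using V.exists_local_transport
  obtain ⟨E, hE, hEU⟩ := lebesgue_number_lemma (isCompact_univ (X := V.M 0)) hUo
    (fun b _ => Set.mem_iUnion.2 ⟨b, hbU b⟩)
  choose k hk using fun x => hEU x (Set.mem_univ x)
  obtain ⟨D, hD, hDs, hDE⟩ := comp_comp_symm_mem_uniformity_sets hE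
  have hex : ∀ x : V.M 0, ∃ C ⊆ UniformSpace.ball x D, IsOpen C ∧ x ∈ C ∧ IsPreconnected C := by
    intro x
    obtain ⟨C, hC, ho, hx, hc⟩ := locallyConnectedSpace_iff_subsets_isOpen_isConnected.1 hlc x _
      (UniformSpace.ball_mem_nhds x hD)
    exact ⟨C, hC, ho, hx, hc.isPreconnected⟩
  choose C hCD hCo hxC hC using hex
  -- Three `D`-steps, from `x` to `u`, to `y`, to `w`, stay within `E`: both local transports are
  -- defined on all of `C y`.
  have hsub : ∀ x y u, u ∈ C x → u ∈ C y → C y ⊆ U (k x) := fun x y u hx hy w hw =>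
    hk x (hDE ⟨y, ⟨u, hCD x hx, hDs.symm _ _ (hCD y hy)⟩, hCD y hw⟩)
  have hsub' : ∀ x, C x ⊆ U (k x) := fun x => hsub x x x (hxC x) (hxC x)
  have agree : ∀ x y a v, V.proj a ∈ C x → V.proj a ∈ C y → v ∈ C x → v ∈ C y →
      T (k x) (a, v) = T (k y) (a, v) := by
    intro x y a v hax hay hvx hvy
    have h1 := hsub x y _ hax hay
    have hc : ∀ z, C y ⊆ U (k z) → ContinuousOn (fun w => T (k z) (a, w)) (C y) := fun z hz =>
      (hT (k z)).cont.comp (by fun_prop) fun w hw => ⟨hz hay, hz hw⟩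
    -- With `a` fixed, both transports are lifts over the connected set `C y`, and both equal `a` at
    -- `V.proj a`.
    refine V.eq_of_lift_on (hC y) (hc x h1) (hc y (hsub' y)) (fun w hw => ?_) hay ?_ hvy
    · rw [(hT _).proj_apply _ ⟨h1 hay, h1 hw⟩, (hT _).proj_apply _ ⟨hsub' y hay, hsub' y hw⟩]
    · rw [(hT _).apply_proj _ ⟨h1 hay, h1 hay⟩, (hT _).apply_proj _ ⟨hsub' y hay, hsub' y hay⟩]
  let T' : S × V.M 0 → S := fun x =>
    if h : ∃ c, V.proj x.1 ∈ C c ∧ x.2 ∈ C c then T (k h.choose) x else x.1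
  have hT' : ∀ x c, V.proj x.1 ∈ C c → x.2 ∈ C c → T' x = T (k c) x := by
    intro x c h1 h2
    have h : ∃ c, V.proj x.1 ∈ C c ∧ x.2 ∈ C c := ⟨c, h1, h2⟩
    simp only [T', dif_pos h]
    exact agree _ _ x.1 x.2 h.choose_spec.1 h1 h.choose_spec.2 h2
  refine ⟨⋃ c, C c ×ˢ C c, isOpen_iUnion fun c => (hCo c).prod (hCo c),
    fun b => Set.mem_iUnion.2 ⟨b, hxC b, hxC b⟩, T', ?_, ?_, ?_⟩
  · intro x hx
    obtain ⟨c, h1, h2⟩ := Set.mem_iUnion.1 hx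
    have hn : {x : S × V.M 0 | V.proj x.1 ∈ C c ∧ x.2 ∈ C c} ∈ 𝓝 x :=
      Filter.inter_mem ((V.continuous_proj.comp continuous_fst).continuousAt.preimage_mem_nhds
        ((hCo c).mem_nhds h1)) (continuous_snd.continuousAt.preimage_mem_nhds
        ((hCo c).mem_nhds h2))
    refine ContinuousAt.continuousWithinAt (ContinuousAt.congr (f := T (k c)) ?_ ?_)
    · exact (hT (k c)).cont.continuousAt
        (Filter.mem_of_superset hn fun y hy => ⟨hsub' c hy.1, hsub' c hy.2⟩)
    · exact Filter.mem_of_superset hn fun y hy => (hT' y c hy.1 hy.2).symm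
  · intro x hx
    obtain ⟨c, h1, h2⟩ := Set.mem_iUnion.1 hx
    rw [hT' x c h1 h2, (hT (k c)).proj_apply _ ⟨hsub' c h1, hsub' c h2⟩]
  · intro a hx
    obtain ⟨c, h1, h2⟩ := Set.mem_iUnion.1 hx
    rw [hT' _ c h1 h2, (hT (k c)).apply_proj _ ⟨hsub' c h1, hsub' c h2⟩]

/-- `V.LoopLifts Γ z`: the projection of the loop `Γ` to the base of the presentation lifts to a
loop at `z`. -/
def LoopLifts (Γ : C(I, S)) (z : S) : Prop :=
  ∃ Γ' : C(I, S), (∀ t, V.proj (Γ' t) = V.proj (Γ t)) ∧ Γ' 0 = z ∧ Γ' 1 = z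

universe w

/-- Comparison of the holonomy of two transverse sections of the same space. -/
theorem exists_nhds_loopLifts (V' : TransverseSection.{w} S) (x : S) {U : Set S} (hU : U ∈ 𝓝 x) :
    ∃ N ∈ 𝓝 x, ∀ z' ∈ N, V'.proj z' = V'.proj x → ∃ z ∈ U, V.proj z = V.proj x ∧
      ∀ Γ : C(I, S), Γ 0 = x → Γ 1 = x → V.LoopLifts Γ z → V'.LoopLifts Γ z' := by
  obtain ⟨W, hWo, hWd, T, hT⟩ := V.exists_transport
  obtain ⟨W', hWo', hWd', T', hT'⟩ := V'.exists_transport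
  have hlc := V.locallyConnectedSpace
  -- Agreement at level `n` of `V` is close enough to allow transport for `V'`.
  obtain ⟨n, hn⟩ := V.exists_level_mem (O := {y | (V'.proj y.1, V'.proj y.2) ∈ W'})
    (hWo'.preimage ((V'.continuous_proj.comp continuous_fst).prodMk
      (V'.continuous_proj.comp continuous_snd))) (fun a => hWd' _)
  obtain ⟨D, hD, hDn⟩ := V.exists_nhds_level_eq x n
  have hopen : IsOpen {y : S × V.M 0 | (V.proj y.1, y.2) ∈ W} :=
    hWo.preimage ((V.continuous_proj.comp continuous_fst).prodMk continuous_snd)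
  have hopen' : IsOpen {y : S × V'.M 0 | (V'.proj y.1, y.2) ∈ W'} :=
    hWo'.preimage ((V'.continuous_proj.comp continuous_fst).prodMk continuous_snd)
  have hTx : T (x, V.proj x) = x := hT.apply_proj x (hWd _)
  have hcont : ContinuousAt T (x, V.proj x) := hT.cont.continuousAt (hopen.mem_nhds (hWd _))
  have hO' : {b | (V'.proj b, V'.proj x) ∈ W'} ∈ 𝓝 x :=
    (hWo'.preimage (V'.continuous_proj.prodMk continuous_const)).mem_nhds (hWd' _)
  have hpre : {y : S × V.M 0 | (V.proj y.1, y.2) ∈ W} ∩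
      T ⁻¹' (U ∩ D ∩ {b | (V'.proj b, V'.proj x) ∈ W'}) ∈ 𝓝 (x, V.proj x) :=
    Filter.inter_mem (hopen.mem_nhds (hWd _)) (hcont.preimage_mem_nhds (by
      rw [hTx]; exact Filter.inter_mem (Filter.inter_mem hU hD) hO'))
  obtain ⟨N₀, hN₀, C₀, hC₀, hsub⟩ := mem_nhds_prod_iff.1 hpre
  obtain ⟨C, hCC, hCo, hxC, hC⟩ :=
    locallyConnectedSpace_iff_subsets_isOpen_isConnected.1 hlc _ _ hC₀
  refine ⟨N₀ ∩ V.proj ⁻¹' C, Filter.inter_mem hN₀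
    (V.continuous_proj.continuousAt.preimage_mem_nhds (hCo.mem_nhds hxC)), ?_⟩
  rintro z' ⟨hz', hzC⟩ hproj
  have hmem : ∀ c ∈ C, (z', c) ∈ {y : S × V.M 0 | (V.proj y.1, y.2) ∈ W} ∩
      T ⁻¹' (U ∩ D ∩ {b | (V'.proj b, V'.proj x) ∈ W'}) := fun c hc => hsub ⟨hz', hCC hc⟩
  obtain ⟨hzW, ⟨hzU, hzD⟩, hzW'⟩ := hmem _ hxC
  have hpz : V.proj (T (z', V.proj x)) = V.proj x := hT.proj_apply _ hzW
  -- The point `z'` is slid along its leaf into the fibre of `V` through `x`.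
  refine ⟨T (z', V.proj x), hzU, hpz, ?_⟩
  -- Sliding back for `V'` recovers `z'`: as `c` varies in the connected set `C`, the result lies
  -- over a constant, so it is constant, and at `c = V.proj z'` it is `z'`.
  have hback : T' (T (z', V.proj x), V'.proj x) = z' := by
    have hself : T (z', V.proj z') = z' := hT.apply_proj z' (hWd _)
    have h2 : T' (T (z', V.proj z'), V'.proj x) = z' := by
      rw [hself, ← hproj]; exact hT'.apply_proj z' (hWd' _)
    refine Eq.trans ?_ h2
    refine V'.eq_of_lift_on (f := fun c => T' (T (z', c), V'.proj x))
      (g := fun _ => T' (T (z', V.proj z'), V'.proj x)) hC.isPreconnected ?_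
      continuousOn_const (fun c hc => ?_) hzC rfl hxC
    · exact hT'.cont.comp ((hT.cont.comp (by fun_prop) fun c hc => (hmem c hc).1).prodMk
        continuousOn_const) fun c hc => (hmem c hc).2.2
    · rw [hT'.proj_apply _ (hmem c hc).2.2, hT'.proj_apply _ (hmem _ hzC).2.2]
  rintro Γ h0 h1 ⟨Δ, hΔ, hΔ0, hΔ1⟩
  have hlev := V.level_eq_of_lift Δ.continuous Γ.continuous hΔ n 0
    (by rw [hΔ0, h0]; exact hDn _ hzD hpz)
  have hclose : ∀ t, (V'.proj (Δ t), V'.proj (Γ t)) ∈ W' := fun t => hn _ _ (hlev t)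
  -- The closed lift `Δ` stays close to `Γ`; sliding each `Δ t` over `V'.proj (Γ t)` gives a lift
  -- for `V'`, closed because `Δ` and `Γ` are.
  refine ⟨⟨fun t => T' (Δ t, V'.proj (Γ t)), hT'.cont.comp_continuous
    (Δ.continuous.prodMk (V'.continuous_proj.comp Γ.continuous)) hclose⟩,
    fun t => hT'.proj_apply _ (hclose t), ?_, ?_⟩
  · simp only [ContinuousMap.coe_mk, hΔ0, h0, hback]
  · simp only [ContinuousMap.coe_mk, hΔ1, h1, hback]

/-- If every loop at `y` has lifts to loops at all points of the fibre near `y`, then the germinal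
holonomy at `y` is trivial. -/
theorem germTrivial_of_loopLifts (y : V.carrier)
    (h : ∀ Γ : C(I, S), Γ 0 = y → Γ 1 = y →
      ∃ N ∈ 𝓝 (y : S), ∀ z ∈ N, V.proj z = V.base → V.LoopLifts Γ z) : V.GermTrivial y := by
  -- Every isotropy element acts as the identity near `y`, so any two of them have the same germ.
  have key : ∀ g ∈ V.isotropy y, ∃ N : Set S, IsOpen N ∧ (y : S) ∈ N ∧
      ∀ z w : V.carrier, (z : S) ∈ N → (V.Holonomy g z w ↔ z = w) := by
    rintro g ⟨γ, rfl, Γ, hΓ, h0, h1⟩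
    obtain ⟨N, hN, hl⟩ := h Γ h0 h1
    obtain ⟨N', hN', ho, hy⟩ := mem_nhds_iff.1 hN
    refine ⟨N', ho, hy, fun z w hz => ⟨?_, ?_⟩⟩
    · rintro ⟨δ, hδ, Δ, hΔ, hΔ0, hΔ1⟩
      obtain ⟨Γ', hΓ', h0', h1'⟩ := hl z (hN' hz) z.2
      have hom : δ.Homotopic γ := Path.Homotopic.Quotient.exact hδ
      have := V.lift_end_eq_of_homotopic hom hΔ (fun t => (hΓ' t).trans (hΓ t))
        (hΔ0.trans h0'.symm)
      exact Subtype.ext (by rw [← hΔ1, this, h1'])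
    · rintro rfl
      obtain ⟨Γ', hΓ', h0', h1'⟩ := hl z (hN' hz) z.2
      exact ⟨γ, rfl, Γ', fun t => (hΓ' t).trans (hΓ t), h0', h1'⟩
  refine ⟨fun g₁ g₂ => ?_⟩
  induction g₁ using Quotient.inductionOn with | _ g₁ => ?_
  induction g₂ using Quotient.inductionOn with | _ g₂ => ?_
  obtain ⟨N₁, ho₁, hy₁, h₁⟩ := key g₁ g₁.2
  obtain ⟨N₂, ho₂, hy₂, h₂⟩ := key g₂ g₂.2
  exact Quotient.sound ⟨Subtype.val ⁻¹' (N₁ ∩ N₂), (ho₁.inter ho₂).preimage continuous_subtype_val,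
    ⟨hy₁, hy₂⟩, fun z hz w => (h₁ z w hz.1).trans (h₂ z w hz.2).symm⟩

/-- If the germinal holonomy at `x` is locally trivial, then all loops at `x` lift to loops at all
points of some neighbourhood of `x` in the fibre. -/
theorem exists_nhds_of_germLocallyTrivial {x : V.carrier} (h : V.GermLocallyTrivial x) :
    ∃ U ∈ 𝓝 (x : S), ∀ z ∈ U, V.proj z = V.base →
      ∀ Γ : C(I, S), Γ 0 = x → Γ 1 = x → V.LoopLifts Γ z := by
  obtain ⟨U, hU, hx, h⟩ := h
  obtain ⟨U', hU', rfl⟩ := isOpen_induced_iff.1 hU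
  refine ⟨U', hU'.mem_nhds hx, fun z hz hb Γ h0 h1 => ?_⟩
  let γ : Path V.base V.base := ⟨⟨fun t => V.proj (Γ t), V.continuous_proj.comp Γ.continuous⟩,
    (congrArg V.proj h0).trans x.2, (congrArg V.proj h1).trans x.2⟩
  obtain ⟨δ, hδ, Δ, hΔ, hΔ0, hΔ1⟩ := h (FundamentalGroup.fromPath (Path.Homotopic.Quotient.mk γ))
    ⟨γ, rfl, Γ, fun t => rfl, h0, h1⟩ ⟨z, hb⟩ hz
  have hom : δ.Homotopic γ := Path.Homotopic.Quotient.exact hδ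
  obtain ⟨Γ', hΓ', h0'⟩ := V.exists_path_lift γ.toContinuousMap z (by
    rw [hb]; exact γ.source)
  have := V.lift_end_eq_of_homotopic hom hΔ hΓ' (hΔ0.trans h0'.symm)
  exact ⟨Γ', hΓ', h0', by rw [← this, hΔ1]⟩

end TransverseSection

/-! ### The planar piece: collars, gluing maps, connectedness. -/

namespace Schori

/-- The plane domain underlying `Piece`. -/
def pieceSet : Set ℂ := {z | 1 / 2 < ‖z‖ ∧ ‖z‖ < 40 ∧ 1 / 2 < ‖z - 6‖ ∧ 1 / 2 < ‖z + 6‖}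

theorem isOpen_pieceSet : IsOpen pieceSet := by
  refine IsOpen.and ?_ (IsOpen.and ?_ (IsOpen.and ?_ ?_))
  · exact isOpen_lt continuous_const continuous_norm
  · exact isOpen_lt continuous_norm continuous_const
  · exact isOpen_lt continuous_const (by fun_prop)
  · exact isOpen_lt continuous_const (by fun_prop)

/-- The gluing maps between the collars; the first index tells the curve (`true` for `C`, `false`
for `D`), the second the direction of the crossing. -/
noncomputable def cross : Bool × Bool → ℂ → ℂ
  | (true, true), z => 20 * z
  | (true, false), z => z / 20
  | (false, true), z => (z - 6)⁻¹ - 6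
  | (false, false), z => (z + 6)⁻¹ + 6

/-- The collars at which the gluing maps are defined. -/
def collar : Bool × Bool → Set ℂ
  | (true, true) => {z | ‖z‖ < 2}
  | (true, false) => {z | 10 < ‖z‖}
  | (false, true) => {z | ‖z - 6‖ < 2}
  | (false, false) => {z | ‖z + 6‖ < 2}

/-- The same crossing in the opposite direction. -/
def rev (s : Bool × Bool) : Bool × Bool := (s.1, !s.2)

theorem mem_collar {z : ℂ} {s : Bool × Bool} (hz : z ∈ pieceSet) (hw : cross s z ∈ pieceSet) :
    z ∈ collar s := by
  obtain ⟨h1, h2, h3, h4⟩ := hz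
  obtain ⟨k1, k2, k3, k4⟩ := hw
  obtain ⟨_ | _, _ | _⟩ := s <;> simp only [cross, collar, Set.mem_ofPred_eq] at *
  · rw [add_sub_cancel_right, norm_inv, lt_inv_comm₀ (by norm_num) (by linarith)] at k3
    linarith
  · rw [sub_add_cancel, norm_inv, lt_inv_comm₀ (by norm_num) (by linarith)] at k4
    linarith
  · rw [norm_div] at k1
    norm_num at k1
    linarith
  · rw [norm_mul] at k2
    norm_num at k2
    linarith

theorem cross_rev (z : ℂ) (s : Bool × Bool) : cross (rev s) (cross s z) = z := by
  obtain ⟨_ | _, _ | _⟩ := s <;> simp [cross, rev]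
  ring

/-- The triangle inequalities among `z`, `0`, `6`, `-6`, which reduce the estimates on collars to
linear arithmetic. -/
theorem norm_bounds (z : ℂ) :
    ‖z - 6‖ ≤ ‖z‖ + 6 ∧ ‖z + 6‖ ≤ ‖z‖ + 6 ∧ ‖z‖ ≤ ‖z - 6‖ + 6 ∧ ‖z‖ ≤ ‖z + 6‖ + 6 ∧
      6 ≤ ‖z‖ + ‖z - 6‖ ∧ 6 ≤ ‖z‖ + ‖z + 6‖ ∧ 12 ≤ ‖z - 6‖ + ‖z + 6‖ := by
  have n6 : ‖(6 : ℂ)‖ = 6 := by norm_num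
  have n12 : ‖(12 : ℂ)‖ = 12 := by norm_num
  have h1 := norm_sub_le z 6
  have h2 := norm_add_le z 6
  have h3 := norm_add_le (z - 6) 6
  have h4 := norm_sub_le (z + 6) 6
  have h5 := norm_sub_le z (z - 6)
  have h6 := norm_sub_le (z + 6) z
  have h7 := norm_sub_le (z + 6) (z - 6)
  rw [sub_add_cancel] at h3
  rw [add_sub_cancel_right] at h4
  rw [sub_sub_cancel] at h5
  rw [add_sub_cancel_left] at h6
  rw [show z + 6 - (z - 6) = 12 by ring] at h7
  refine ⟨?_, ?_, ?_, ?_, ?_, ?_, ?_⟩ <;> linarith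

theorem collar_inj {z : ℂ} {s t : Bool × Bool} (hs : z ∈ collar s) (ht : z ∈ collar t) : s = t := by
  obtain ⟨h1, h2, h3, h4, h5, h6, h7⟩ := norm_bounds z
  obtain ⟨_ | _, _ | _⟩ := s <;> obtain ⟨_ | _, _ | _⟩ := t <;>
    simp only [collar, Set.mem_ofPred_eq] at hs ht <;> first | rfl | (exfalso; linarith)

/-- Points glued to each other are far apart in the plane, so a disc of radius 1 contains no such
pair. -/
theorem collar_dist {z w : ℂ} {s : Bool × Bool} (hz : z ∈ collar s) (hw : w ∈ collar (rev s)) :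
    2 < ‖z - w‖ := by
  obtain ⟨h1, h2, h3, h4, h5, h6, h7⟩ := norm_bounds z
  obtain ⟨k1, k2, k3, k4, k5, k6, k7⟩ := norm_bounds w
  have e1 := norm_sub_norm_le z w
  have e2 := norm_sub_norm_le w z
  have e3 := norm_sub_norm_le (z - 6) (w - 6)
  have e4 := norm_sub_norm_le (w - 6) (z - 6)
  rw [norm_sub_rev] at e2
  rw [show z - 6 - (w - 6) = z - w by ring] at e3
  rw [show w - 6 - (z - 6) = w - z by ring, norm_sub_rev w z] at e4
  obtain ⟨_ | _, _ | _⟩ := s <;> simp only [collar, rev, Set.mem_ofPred_eq, Bool.not_true,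
    Bool.not_false] at hz hw <;> linarith

theorem continuous_cross (s : Bool × Bool) : Continuous fun z : Piece => cross s z.1 := by
  have hc : Continuous fun z : Piece => z.1 := continuous_subtype_val
  obtain ⟨_ | _, _ | _⟩ := s <;> simp only [cross]
  · refine ((hc.add continuous_const).inv₀ fun z h => ?_).add continuous_const
    have := z.2.2.2.2
    rw [show z.1 + 6 = 0 from h, norm_zero] at this
    linarith
  · refine ((hc.sub continuous_const).inv₀ fun z h => ?_).sub continuous_const
    have := z.2.2.2.1
    rw [show z.1 - 6 = 0 from h, norm_zero] at this
    linarith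
  · fun_prop
  · fun_prop

section Connected

theorem isPreconnected_annulus : IsPreconnected {z : ℂ | 7 < ‖z‖ ∧ ‖z‖ < 40} := by
  have : {z : ℂ | 7 < ‖z‖ ∧ ‖z‖ < 40} =
      (fun x : ℝ × ℝ => (x.1 : ℂ) * Complex.exp (x.2 * Complex.I)) ''
        (Set.Ioo 7 40 ×ˢ Set.univ) := by
    ext z
    simp only [Set.mem_ofPred_eq, Set.mem_image, Set.mem_prod, Set.mem_Ioo, Set.mem_univ, and_true,
      Prod.exists]
    constructor
    · intro h
      exact ⟨‖z‖, Complex.arg z, h, Complex.norm_mul_exp_arg_mul_I z⟩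
    · rintro ⟨r, θ, h, rfl⟩
      rw [norm_mul, Complex.norm_exp_ofReal_mul_I, mul_one, Complex.norm_real, Real.norm_eq_abs,
        abs_of_pos (by linarith [h.1])]
      exact h
  rw [this]
  exact (isPreconnected_Ioo.prod isPreconnected_univ).image _ (by fun_prop)

theorem annulus_subset : {z : ℂ | 7 < ‖z‖ ∧ ‖z‖ < 40} ⊆ pieceSet := by
  rintro z ⟨h, h'⟩
  obtain ⟨h1, h2, h3, h4, h5, h6, h7⟩ := norm_bounds z
  exact ⟨by linarith, h', by linarith, by linarith⟩

theorem normSq_lt {z : ℂ} {c : ℝ} (hc : 0 ≤ c) : c < ‖z‖ ↔ c ^ 2 < z.re ^ 2 + z.im ^ 2 := by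
  rw [← sq_lt_sq₀ hc (norm_nonneg _), Complex.sq_norm, Complex.normSq_apply]
  ring_nf

theorem isPreconnected_pieceSet : IsPreconnected pieceSet := by
  have h20 : (20 : ℂ) ∈ {z : ℂ | 7 < ‖z‖ ∧ ‖z‖ < 40} := by norm_num
  refine isPreconnected_of_forall (20 : ℂ) fun z hz => ?_
  by_cases h7 : 7 < ‖z‖
  · exact ⟨_, annulus_subset, h20, ⟨h7, hz.2.1⟩, isPreconnected_annulus⟩
  -- The three removed discs are centred on the real axis. Moving vertically away from that axis
  -- increases the distances to the centres; after a length of 20 the point, initially of norm at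
  -- most 7, is in the annulus.
  obtain ⟨ε, hε, hεz⟩ : ∃ ε : ℝ, (ε = 1 ∨ ε = -1) ∧ 0 ≤ ε * z.im := by
    rcases le_total 0 z.im with h | h
    · exact ⟨1, .inl rfl, by linarith⟩
    · exact ⟨-1, .inr rfl, by linarith⟩
  have hε2 : ε ^ 2 = 1 := by rcases hε with rfl | rfl <;> norm_num
  let f : ℝ → ℂ := fun t => z + (ε * t : ℝ) * Complex.I
  have him : ∀ t, 0 ≤ t → z.im ^ 2 + t ^ 2 ≤ (z.im + ε * t) ^ 2 := fun t ht => by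
    have : 0 ≤ t * (ε * z.im) := mul_nonneg ht hεz
    nlinarith
  have key : ∀ (t c r : ℝ), 0 ≤ t → 0 ≤ r → r < ‖z + c‖ → r < ‖f t + c‖ := by
    intro t c r ht hr h
    have := him t ht
    rw [normSq_lt hr] at h ⊢
    simp only [f, Complex.add_re, Complex.add_im, Complex.mul_re, Complex.mul_im, Complex.ofReal_re,
      Complex.ofReal_im, Complex.I_re, Complex.I_im] at h ⊢
    ring_nf at h this ⊢
    nlinarith [sq_nonneg t]
  have hup : ∀ t ∈ Set.Icc (0 : ℝ) 20, ‖f t‖ < 40 := fun t ht => by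
    have h1 := norm_add_le z ((ε * t : ℝ) * Complex.I)
    rw [norm_mul, Complex.norm_I, mul_one, Complex.norm_real, Real.norm_eq_abs, abs_mul,
      abs_of_nonneg ht.1] at h1
    have h2 : |ε| = 1 := by rcases hε with rfl | rfl <;> norm_num
    rw [h2] at h1
    push Not at h7
    linarith [ht.2]
  have hf : f '' Set.Icc 0 20 ⊆ pieceSet := by
    rintro _ ⟨t, ht, rfl⟩
    have k0 := key t 0 (1 / 2) ht.1 (by norm_num) (by simpa using hz.1)
    have k1 := key t (-6) (1 / 2) ht.1 (by norm_num)
      (by simpa [← sub_eq_add_neg] using hz.2.2.1)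
    have k2 := key t 6 (1 / 2) ht.1 (by norm_num) (by simpa using hz.2.2.2)
    exact ⟨by simpa using k0, hup t ht, by simpa [← sub_eq_add_neg] using k1, by simpa using k2⟩
  have h20' : f 20 ∈ {z : ℂ | 7 < ‖z‖ ∧ ‖z‖ < 40} := by
    refine ⟨?_, hup 20 (by norm_num)⟩
    have := him 20 (by norm_num)
    rw [normSq_lt (by norm_num)]
    simp only [f, Complex.add_re, Complex.add_im, Complex.mul_re, Complex.mul_im, Complex.ofReal_re,
      Complex.ofReal_im, Complex.I_re, Complex.I_im]
    ring_nf at this ⊢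
    nlinarith [sq_nonneg z.re, sq_nonneg z.im]
  refine ⟨f '' Set.Icc 0 20 ∪ {z : ℂ | 7 < ‖z‖ ∧ ‖z‖ < 40}, Set.union_subset hf annulus_subset,
    .inr h20, .inl ⟨0, by norm_num, by simp [f]⟩, ?_⟩
  refine IsPreconnected.union (f 20) ⟨20, by norm_num, rfl⟩ h20' ?_ isPreconnected_annulus
  exact isPreconnected_Icc.image _ (by fun_prop)

instance : PathConnectedSpace Piece := by
  refine isPathConnected_iff_pathConnectedSpace.1
    (isOpen_pieceSet.isConnected_iff_isPathConnected.1 ⟨⟨20, ?_⟩, isPreconnected_pieceSet⟩)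
  exact annulus_subset (by norm_num)

end Connected

end Schori

/-! ### Closed surfaces glued from pieces with an arbitrary index set. -/

namespace Schori

open Topology

theorem isOpenEmbedding_val : IsOpenEmbedding fun z : Piece => z.1 :=
  isOpen_pieceSet.isOpenEmbedding_subtypeVal

theorem range_val : Set.range (fun z : Piece => z.1) = pieceSet := Subtype.range_coe

/-- A neighbourhood of a point of a piece no two points of which are glued. -/
def smallNhd (z₀ : Piece) : Set Piece := {z | ‖z.1 - z₀.1‖ < 1}

theorem isOpen_smallNhd (z₀ : Piece) : IsOpen (smallNhd z₀) :=
  isOpen_lt ((continuous_subtype_val.sub continuous_const).norm) continuous_const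

theorem mem_smallNhd (z₀ : Piece) : z₀ ∈ smallNhd z₀ := by simp [smallNhd]

theorem smallNhd_dist {z₀ z w : Piece} (hz : z ∈ smallNhd z₀) (hw : w ∈ smallNhd z₀) :
    ‖z.1 - w.1‖ ≤ 2 := by
  have := norm_sub_le_norm_sub_add_norm_sub z.1 z₀.1 w.1
  rw [norm_sub_rev z₀.1] at this
  simp only [smallNhd, Set.mem_ofPred_eq] at hz hw
  linarith

section Surf

variable {ι : Type} (a b : Equiv.Perm ι)

/-- The surface glued from pieces indexed by `ι` by means of the permutations `a` and `b`. -/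
def Surf : Type := Quot (Glue a b)

instance [TopologicalSpace ι] : TopologicalSpace (Surf a b) :=
  inferInstanceAs (TopologicalSpace (Quot _))

/-- The point of the surface represented by a point of a piece. -/
def Surf.mk (p : ι × Piece) : Surf a b := Quot.mk _ p

/-- The change of the index of the piece at a crossing. -/
def shift : Bool × Bool → Equiv.Perm ι
  | (true, true) => a
  | (true, false) => a⁻¹
  | (false, true) => b
  | (false, false) => b⁻¹

theorem shift_rev_apply (s : Bool × Bool) (i : ι) : shift a b (rev s) (shift a b s i) = i := by
  obtain ⟨_ | _, _ | _⟩ := s <;> simp [shift, rev]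

/-- Two points of pieces that are glued. -/
def Adj (s : Bool × Bool) (p q : ι × Piece) : Prop :=
  q.1 = shift a b s p.1 ∧ (q.2.1 : ℂ) = cross s p.2.1

variable {a b}

theorem Adj.symm {s : Bool × Bool} {p q : ι × Piece} (h : Adj a b s p q) : Adj a b (rev s) q p :=
  ⟨by rw [h.1, shift_rev_apply], by rw [h.2, cross_rev]⟩

theorem Adj.mem_collar {s : Bool × Bool} {p q : ι × Piece} (h : Adj a b s p q) :
    p.2.1 ∈ collar s :=
  Schori.mem_collar p.2.2 (h.2 ▸ q.2.2)

theorem Adj.dist {s : Bool × Bool} {p q : ι × Piece} (h : Adj a b s p q) :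
    2 < ‖p.2.1 - q.2.1‖ :=
  collar_dist h.mem_collar h.symm.mem_collar

/-- The collars are disjoint, so the collar containing `q` determines the crossing: a second gluing
undoes the first. The generated equivalence relation therefore needs only one step. -/
theorem Adj.eq_of_adj {s t : Bool × Bool} {p q r : ι × Piece} (h : Adj a b s p q)
    (h' : Adj a b t q r) : p = r := by
  obtain rfl : rev s = t := collar_inj h.symm.mem_collar h'.mem_collar
  exact Prod.ext (by rw [h'.1, h.1, shift_rev_apply])
    (Subtype.ext (by rw [h'.2, h.2, cross_rev]))

theorem Adj.sound {s : Bool × Bool} {p q : ι × Piece} (h : Adj a b s p q) :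
    Surf.mk a b p = Surf.mk a b q := by
  have key : ∀ (c : Bool) {p q : ι × Piece}, Adj a b (c, true) p q →
      Surf.mk a b p = Surf.mk a b q := by
    rintro c ⟨i, z⟩ ⟨j, w⟩ ⟨h1, h2⟩
    obtain rfl : j = shift a b (c, true) i := h1
    cases c
    · refine Quot.sound (Glue.crossD i z w ?_)
      have : (z.1 - 6) ≠ 0 := fun h0 => by
        have := z.2.2.2.1
        rw [h0, norm_zero] at this
        linarith
      simp only [cross] at h2
      rw [h2, sub_add_cancel, mul_inv_cancel₀ this]
    · exact Quot.sound (Glue.crossC i z w h2)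
  obtain ⟨c, _ | _⟩ := s
  · exact (key c h.symm).symm
  · exact key c h

theorem adj_of_glue {p q : ι × Piece} (h : Glue a b p q) : ∃ s, Adj a b s p q := by
  obtain ⟨v, z, w, h⟩ | ⟨v, z, w, h⟩ := h
  · exact ⟨(true, true), rfl, h⟩
  · refine ⟨(false, true), rfl, ?_⟩
    simp only [cross]
    rw [eq_sub_iff_add_eq]
    exact eq_inv_of_mul_eq_one_right h

theorem Surf.mk_eq_mk {p q : ι × Piece} :
    Surf.mk a b p = Surf.mk a b q ↔ p = q ∨ ∃ s, Adj a b s p q := by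
  constructor
  · intro h
    have hg : Relation.EqvGen (Glue a b) p q := Quot.eqvGen_exact h
    clear h
    induction hg with
    | rel p q h => exact .inr (adj_of_glue h)
    | refl p => exact .inl rfl
    | symm p q _ ih =>
      obtain rfl | ⟨s, h⟩ := ih
      · exact .inl rfl
      · exact .inr ⟨_, h.symm⟩
    | trans p q r _ _ ih ih' =>
      obtain rfl | ⟨s, h⟩ := ih
      · exact ih'
      · obtain rfl | ⟨t, h'⟩ := ih'
        · exact .inr ⟨s, h⟩
        · exact .inl (h.eq_of_adj h')
  · rintro (rfl | ⟨s, h⟩)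
    · rfl
    · exact h.sound

theorem Surf.eq_of_mk_eq_mk {p q : ι × Piece} (h : Surf.mk a b p = Surf.mk a b q)
    (hd : ‖p.2.1 - q.2.1‖ ≤ 2) : p = q := by
  obtain h | ⟨s, h⟩ := Surf.mk_eq_mk.1 h
  · exact h
  · exact absurd h.dist (not_lt.2 hd)

theorem Surf.mk_index_inj {i j : ι} {z : Piece} (h : Surf.mk a b (i, z) = Surf.mk a b (j, z)) :
    i = j :=
  congrArg Prod.fst (Surf.eq_of_mk_eq_mk h (by simp))

theorem Surf.mk_surjective : Function.Surjective (Surf.mk a b) := Quot.mk_surjective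

variable [TopologicalSpace ι]

theorem Surf.continuous_mk : Continuous (Surf.mk a b) := continuous_quot_mk

/-- The compact cores of the finitely many pieces cover the surface: a point outside its core lies
in the outer half of one collar, and crossing there leads into a core. -/
theorem Surf.compactSpace [Finite ι] : CompactSpace (Surf a b) := by
  let K : Set ℂ := {z | 1 ≤ ‖z‖ ∧ ‖z‖ ≤ 20 ∧ 1 ≤ ‖z - 6‖ ∧ 1 ≤ ‖z + 6‖}
  have hKP : K ⊆ pieceSet := fun z hz => ⟨by linarith [hz.1], by linarith [hz.2.1],
    by linarith [hz.2.2.1], by linarith [hz.2.2.2]⟩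
  have hK : IsCompact K := by
    refine (isCompact_closedBall (0 : ℂ) 20).of_isClosed_subset ?_ fun z hz => by
      simpa using hz.2.1
    refine IsClosed.and ?_ (IsClosed.and ?_ (IsClosed.and ?_ ?_)) <;>
    exact isClosed_le (by fun_prop) (by fun_prop)
  have hK' : IsCompact ((fun z : Piece => z.1) ⁻¹' K) := by
    rw [isOpenEmbedding_val.isEmbedding.isCompact_iff, Set.image_preimage_eq_inter_range,
      range_val]
    rwa [Set.inter_eq_self_of_subset_left hKP]
  have hI : IsCompact (Set.univ : Set ι) := Set.finite_univ.isCompact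
  refine ⟨?_⟩
  convert (hI.prod hK').image (Surf.continuous_mk (a := a) (b := b))
  refine (Set.eq_univ_of_forall fun x => ?_).symm
  obtain ⟨⟨i, z⟩, rfl⟩ := Surf.mk_surjective x
  by_cases hz : z.1 ∈ K
  · exact ⟨(i, z), ⟨trivial, hz⟩, rfl⟩
  suffices ∃ s, cross s z.1 ∈ K by
    obtain ⟨s, hs⟩ := this
    refine ⟨(shift a b s i, ⟨_, hKP hs⟩), ⟨trivial, hs⟩, ?_⟩
    exact (Adj.sound (s := s) ⟨rfl, rfl⟩).symm
  obtain ⟨h1, h2, h3, h4⟩ := z.2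
  simp only [K, Set.mem_ofPred_eq] at hz
  by_cases c1 : 1 ≤ ‖z.1‖
  · by_cases c2 : ‖z.1‖ ≤ 20
    · by_cases c3 : 1 ≤ ‖z.1 - 6‖
      · have c4 : ‖z.1 + 6‖ < 1 := by
          by_contra h
          exact hz ⟨c1, c2, c3, not_lt.1 h⟩
        refine ⟨(false, false), ?_⟩
        obtain ⟨b1, b2, b3, b4, b5, b6, b7⟩ := norm_bounds ((z.1 + 6)⁻¹ + 6)
        have e : ‖(z.1 + 6)⁻¹ + 6 - 6‖ = ‖z.1 + 6‖⁻¹ := by rw [add_sub_cancel_right, norm_inv]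
        have l1 : 1 ≤ ‖z.1 + 6‖⁻¹ := (one_le_inv₀ (by linarith)).2 c4.le
        have l2 : ‖z.1 + 6‖⁻¹ < 2 := (inv_lt_comm₀ (by linarith) (by norm_num)).2 (by linarith)
        rw [e] at b1 b3 b5 b7
        exact ⟨by simp only [cross]; linarith, by simp only [cross]; linarith,
          by simp only [cross]; rw [e]; linarith, by simp only [cross]; linarith⟩
      · refine ⟨(false, true), ?_⟩
        obtain ⟨b1, b2, b3, b4, b5, b6, b7⟩ := norm_bounds ((z.1 - 6)⁻¹ - 6)
        have e : ‖(z.1 - 6)⁻¹ - 6 + 6‖ = ‖z.1 - 6‖⁻¹ := by rw [sub_add_cancel, norm_inv]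
        have l1 : 1 ≤ ‖z.1 - 6‖⁻¹ := (one_le_inv₀ (by linarith)).2 (not_le.1 c3).le
        have l2 : ‖z.1 - 6‖⁻¹ < 2 := (inv_lt_comm₀ (by linarith) (by norm_num)).2 (by linarith)
        rw [e] at b2 b4 b6 b7
        exact ⟨by simp only [cross]; linarith, by simp only [cross]; linarith,
          by simp only [cross]; linarith, by simp only [cross]; rw [e]; linarith⟩
    · refine ⟨(true, false), ?_⟩
      obtain ⟨b1, b2, b3, b4, b5, b6, b7⟩ := norm_bounds (z.1 / 20)
      have e : ‖z.1 / 20‖ = ‖z.1‖ / 20 := by rw [norm_div]; norm_num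
      exact ⟨by simp only [cross]; linarith, by simp only [cross]; linarith,
        by simp only [cross]; linarith, by simp only [cross]; linarith⟩
  · refine ⟨(true, true), ?_⟩
    obtain ⟨b1, b2, b3, b4, b5, b6, b7⟩ := norm_bounds (20 * z.1)
    have e : ‖20 * z.1‖ = 20 * ‖z.1‖ := by rw [norm_mul]; norm_num
    exact ⟨by simp only [cross]; linarith, by simp only [cross]; linarith,
      by simp only [cross]; linarith, by simp only [cross]; linarith⟩

variable [DiscreteTopology ι]

theorem Surf.isOpenMap_mk : IsOpenMap (Surf.mk a b) := by
  intro O hO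
  refine (isQuotientMap_quot_mk (r := Glue a b)).isOpen_preimage.1 ?_
  change IsOpen (Surf.mk a b ⁻¹' (Surf.mk a b '' O))
  have : Surf.mk a b ⁻¹' (Surf.mk a b '' O) = O ∪ ⋃ s, {p | ∃ q ∈ O, Adj a b s p q} := by
    ext p
    simp only [Set.mem_preimage, Set.mem_image, Set.mem_union, Set.mem_iUnion, Set.mem_ofPred_eq]
    constructor
    · rintro ⟨q, hq, h⟩
      obtain rfl | ⟨s, h⟩ := Surf.mk_eq_mk.1 h
      · exact .inl hq
      · exact .inr ⟨_, q, hq, h.symm⟩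
    · rintro (h | ⟨s, q, hq, h⟩)
      · exact ⟨p, h, rfl⟩
      · exact ⟨q, hq, h.sound.symm⟩
  rw [this]
  refine hO.union (isOpen_iUnion fun s => ?_)
  let P : Set (ι × Piece) := {p | cross s p.2.1 ∈ pieceSet}
  have hP : IsOpen P := isOpen_pieceSet.preimage ((continuous_cross s).comp continuous_snd)
  let g : P → ι × Piece := fun p => (shift a b s p.1.1, ⟨cross s p.1.2.1, p.2⟩)
  have hg : Continuous g :=
    (continuous_of_discreteTopology.comp (continuous_fst.comp continuous_subtype_val)).prodMk
      (Continuous.subtype_mk ((continuous_cross s).comp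
        (continuous_snd.comp continuous_subtype_val)) _)
  convert hP.isOpenMap_subtype_val _ (hO.preimage hg) using 1
  ext p
  simp only [Set.mem_ofPred_eq, Set.mem_image, Set.mem_preimage, Subtype.exists]
  constructor
  · rintro ⟨q, hq, h⟩
    have hp : p ∈ P := by
      change cross s p.2.1 ∈ pieceSet
      rw [← h.2]
      exact q.2.2
    refine ⟨p, hp, ?_, rfl⟩
    convert hq using 1
    exact Prod.ext h.1.symm (Subtype.ext h.2.symm)
  · rintro ⟨p, hp, h, rfl⟩
    exact ⟨_, h, rfl, rfl⟩

theorem Surf.isOpenEmbedding_mk_comp {X : Type*} [TopologicalSpace X] {f : X → ι × Piece}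
    (hf : IsOpenEmbedding f) (hinj : Function.Injective fun x => Surf.mk a b (f x)) :
    IsOpenEmbedding fun x => Surf.mk a b (f x) :=
  .of_continuous_injective_isOpenMap (Surf.continuous_mk.comp hf.continuous) hinj
    (Surf.isOpenMap_mk.comp hf.isOpenMap)

/-- The quotient map is open, and the gluing relation is closed, being the diagonal together with
four closed relations `Adj`. -/
theorem Surf.t2Space : T2Space (Surf a b) := by
  have hq : IsOpenQuotientMap (Surf.mk a b) :=
    ⟨Surf.mk_surjective, Surf.continuous_mk, Surf.isOpenMap_mk⟩
  rw [t2Space_iff_of_isOpenQuotientMap hq]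
  have : T2Space Piece := inferInstanceAs (T2Space (Subtype _))
  have : {q : (ι × Piece) × (ι × Piece) | Surf.mk a b q.1 = Surf.mk a b q.2} =
      {q | q.1 = q.2} ∪ ⋃ s, {q | Adj a b s q.1 q.2} := by
    ext q
    simp [Surf.mk_eq_mk]
  rw [this]
  refine (isClosed_eq continuous_fst continuous_snd).union (isClosed_iUnion_of_finite fun s => ?_)
  refine IsClosed.and ?_ ?_
  · exact isClosed_eq (continuous_fst.comp continuous_snd)
      (continuous_of_discreteTopology.comp (continuous_fst.comp continuous_fst))
  · exact isClosed_eq (continuous_subtype_val.comp (continuous_snd.comp continuous_snd))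
      ((continuous_cross s).comp (continuous_snd.comp continuous_fst))

/-- With `J` a singleton this gives charts; with `J` a fibre of a map of indices it gives the sheets
over an evenly covered disc. -/
theorem Surf.isOpenEmbedding_small (z₀ : Piece) (J : Set ι) :
    IsOpenEmbedding fun x : smallNhd z₀ × J => Surf.mk a b (x.2.1, x.1.1) := by
  refine Surf.isOpenEmbedding_mk_comp (f := fun x : smallNhd z₀ × J => (x.2.1, x.1.1)) ?_ ?_
  · exact ((isOpen_discrete J).isOpenEmbedding_subtypeVal.prodMap
      (isOpen_smallNhd z₀).isOpenEmbedding_subtypeVal).comp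
        (Homeomorph.prodComm _ _).isOpenEmbedding
  · intro x y h
    have := Surf.eq_of_mk_eq_mk h (smallNhd_dist x.1.2 y.1.2)
    exact Prod.ext (Subtype.ext (congrArg Prod.snd this)) (Subtype.ext (congrArg Prod.fst this))

theorem Surf.nonempty_chartedSpace :
    Nonempty (ChartedSpace (EuclideanSpace ℝ (Fin 2)) (Surf a b)) := by
  have hE : IsOpenEmbedding fun z : Piece => Complex.orthonormalBasisOneI.repr z.1 :=
    Complex.orthonormalBasisOneI.repr.toHomeomorph.isOpenEmbedding.comp
      isOpen_pieceSet.isOpenEmbedding_subtypeVal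
  have : ∀ x : Surf a b, ∃ e : OpenPartialHomeomorph (Surf a b) (EuclideanSpace ℝ (Fin 2)),
      x ∈ e.source := by
    intro x
    obtain ⟨⟨i, z⟩, rfl⟩ := Surf.mk_surjective x
    have : Nonempty (smallNhd z) := ⟨⟨z, mem_smallNhd z⟩⟩
    have h1 : IsOpenEmbedding fun w : smallNhd z => Surf.mk a b (i, w.1) :=
      (Surf.isOpenEmbedding_small z {i}).comp
        (Homeomorph.prodUnique (smallNhd z) ({i} : Set ι)).symm.isOpenEmbedding
    have h2 := hE.comp (isOpen_smallNhd z).isOpenEmbedding_subtypeVal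
    refine ⟨(h1.toOpenPartialHomeomorph _).symm.trans (h2.toOpenPartialHomeomorph _), ?_⟩
    simp only [OpenPartialHomeomorph.trans_source, OpenPartialHomeomorph.symm_source,
      Topology.IsOpenEmbedding.toOpenPartialHomeomorph_target,
      Topology.IsOpenEmbedding.toOpenPartialHomeomorph_source, Set.preimage_univ, Set.inter_univ]
    exact ⟨⟨z, mem_smallNhd z⟩, rfl⟩
  choose e he using this
  exact ⟨⟨Set.range e, e, he, fun x => ⟨x, rfl⟩⟩⟩

end Surf

/-! ### Coverings induced by equivariant maps of indices. -/

section Map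

variable {ι J : Type} {a b : Equiv.Perm ι} {a' b' : Equiv.Perm J}

/-- The map of surfaces induced by a map of the sets of indices. -/
def Surf.map (φ : ι → J) (ha : ∀ i, φ (a i) = a' (φ i)) (hb : ∀ i, φ (b i) = b' (φ i)) :
    Surf a b → Surf a' b' :=
  Quot.map (fun q : ι × Piece => ((φ q.1, q.2) : J × Piece)) (by
    rintro _ _ (⟨v, z, w, h⟩ | ⟨v, z, w, h⟩)
    · simpa only [ha] using Glue.crossC (φ v) z w h
    · simpa only [hb] using Glue.crossD (φ v) z w h)

variable {φ : ι → J} {ha : ∀ i, φ (a i) = a' (φ i)} {hb : ∀ i, φ (b i) = b' (φ i)}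

theorem shift_map (ha : ∀ i, φ (a i) = a' (φ i)) (hb : ∀ i, φ (b i) = b' (φ i)) (s : Bool × Bool)
    (i : ι) : φ (shift a b s i) = shift a' b' s (φ i) := by
  obtain ⟨_ | _, _ | _⟩ := s <;> simp only [shift]
  · rw [Equiv.Perm.eq_inv_iff_eq, ← hb]
    simp
  · exact hb i
  · rw [Equiv.Perm.eq_inv_iff_eq, ← ha]
    simp
  · exact ha i

@[simp] theorem Surf.map_mk (p : ι × Piece) :
    Surf.map φ ha hb (Surf.mk a b p) = Surf.mk a' b' (φ p.1, p.2) := rfl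

theorem Surf.exists_of_map_eq {x : Surf a b} {j : J} {z : Piece}
    (h : Surf.map φ ha hb x = Surf.mk a' b' (j, z)) : ∃ i, φ i = j ∧ x = Surf.mk a b (i, z) := by
  obtain ⟨⟨i, w⟩, rfl⟩ := Surf.mk_surjective x
  rw [Surf.map_mk] at h
  obtain h | ⟨s, h⟩ := Surf.mk_eq_mk.1 h
  · rw [Prod.mk.injEq] at h
    exact ⟨i, h.1, by rw [← h.2]⟩
  · refine ⟨shift a b s i, ?_, Adj.sound (s := s) ⟨rfl, h.2⟩⟩
    rw [shift_map ha hb]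
    exact h.1.symm

variable [TopologicalSpace ι] [DiscreteTopology ι] [TopologicalSpace J] [DiscreteTopology J]

omit [DiscreteTopology J] in
theorem Surf.continuous_map : Continuous (Surf.map φ ha hb) :=
  continuous_quot_lift _ (Surf.continuous_mk.comp
    ((continuous_of_discreteTopology.comp continuous_fst).prodMk continuous_snd))

theorem Surf.isCoveringMap_map : IsCoveringMap (Surf.map φ ha hb) := by
  intro y
  obtain ⟨⟨j, z₀⟩, rfl⟩ := Surf.mk_surjective y
  suffices IsEvenlyCovered (Surf.map φ ha hb) (Surf.mk a' b' (j, z₀)) (φ ⁻¹' {j}) from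
    this.to_isEvenlyCovered_preimage
  have h1 := Surf.isOpenEmbedding_small (a := a) (b := b) z₀ (φ ⁻¹' {j})
  have h2 : IsOpenEmbedding fun w : smallNhd z₀ => Surf.mk a' b' (j, w.1) :=
    (Surf.isOpenEmbedding_small z₀ {j}).comp
      (Homeomorph.prodUnique (smallNhd z₀) ({j} : Set J)).symm.isOpenEmbedding
  have hr : Surf.map φ ha hb ⁻¹' Set.range (fun w : smallNhd z₀ => Surf.mk a' b' (j, w.1)) =
      Set.range (fun x : smallNhd z₀ × (φ ⁻¹' {j} : Set ι) => Surf.mk a b (x.2.1, x.1.1)) := by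
    ext x
    constructor
    · rintro ⟨w, hw⟩
      obtain ⟨i, hi, rfl⟩ := Surf.exists_of_map_eq hw.symm
      exact ⟨(w, ⟨i, hi⟩), rfl⟩
    · rintro ⟨⟨w, ⟨i, hi⟩⟩, rfl⟩
      refine ⟨w, ?_⟩
      rw [Surf.map_mk, show φ i = j from hi]
  refine ⟨inferInstance, Set.range fun w : smallNhd z₀ => Surf.mk a' b' (j, w.1),
    ⟨⟨z₀, mem_smallNhd z₀⟩, rfl⟩, h2.isOpen_range,
    h2.isOpen_range.preimage Surf.continuous_map,
    ((Homeomorph.setCongr hr).trans h1.isEmbedding.toHomeomorph.symm).trans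
      (h2.isEmbedding.toHomeomorph.prodCongr (Homeomorph.refl _)), ?_⟩
  rintro ⟨x, hx⟩
  obtain ⟨⟨w, ⟨i, hi⟩⟩, rfl⟩ : x ∈ Set.range _ := hr ▸ hx
  have : h1.isEmbedding.toHomeomorph.symm (Homeomorph.setCongr hr ⟨_, hx⟩) = (w, ⟨i, hi⟩) := by
    rw [Homeomorph.symm_apply_eq]
    rfl
  simp only [Homeomorph.trans_apply, this]
  rw [Surf.map_mk, show φ i = j from hi]
  rfl

end Map

/-! ### Words in the two crossings and path connectedness. -/

section Action

variable {ι : Type} (a b : Equiv.Perm ι)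

/-- The action of the free group with generators `true` and `false` through `a` and `b`. -/
def act : FreeGroup Bool →* Equiv.Perm ι := FreeGroup.lift fun c => cond c a b

@[simp] theorem act_true : act a b (FreeGroup.of true) = a := by simp [act]

@[simp] theorem act_false : act a b (FreeGroup.of false) = b := by simp [act]

theorem act_map {J : Type} {a' b' : Equiv.Perm J} {φ : ι → J} (ha : ∀ i, φ (a i) = a' (φ i))
    (hb : ∀ i, φ (b i) = b' (φ i)) (f : FreeGroup Bool) (i : ι) :
    φ (act a b f i) = act a' b' f (φ i) := by
  induction f using FreeGroup.induction_on generalizing i with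
  | C1 => simp
  | of c => cases c <;> simp [ha, hb]
  | inv_of c _ =>
    rw [map_inv, map_inv, Equiv.Perm.eq_inv_iff_eq]
    cases c <;> simp [← ha, ← hb]
  | mul f g hf hg => simp [hf, hg]

variable [TopologicalSpace ι]

variable {a b}

theorem Surf.joined_piece (i : ι) (z w : Piece) :
    Joined (Surf.mk a b (i, z)) (Surf.mk a b (i, w)) :=
  ⟨(PathConnectedSpace.joined z w).somePath.map
    (f := fun z => Surf.mk a b (i, z)) (Surf.continuous_mk.comp (by fun_prop))⟩

theorem Surf.joined_shift (c : Bool) (i : ι) (z w : Piece) :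
    Joined (Surf.mk a b (i, z)) (Surf.mk a b (cond c a b i, w)) := by
  obtain ⟨z', w', h⟩ : ∃ z' w' : Piece, Surf.mk a b (i, z') = Surf.mk a b (cond c a b i, w') := by
    cases c
    · refine ⟨⟨7, ?_⟩, ⟨-5, ?_⟩, Quot.sound (Glue.crossD _ _ _ ?_)⟩ <;> norm_num
    · refine ⟨⟨1, ?_⟩, ⟨20, ?_⟩, Quot.sound (Glue.crossC _ _ _ ?_)⟩ <;> norm_num
  have := (joined_piece (a := a) (b := b) i z z')
  rw [h] at this
  exact this.trans (joined_piece _ w' w)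

theorem Surf.joined_act (f : FreeGroup Bool) (i : ι) (z w : Piece) :
    Joined (Surf.mk a b (i, z)) (Surf.mk a b (act a b f i, w)) := by
  induction f using FreeGroup.induction_on generalizing i z w with
  | C1 => simpa using joined_piece i z w
  | of c =>
    cases c
    · simpa using joined_shift (a := a) (b := b) false i z w
    · simpa using joined_shift (a := a) (b := b) true i z w
  | inv_of c h =>
    rw [map_inv]
    simpa using (h ((act a b (FreeGroup.of c))⁻¹ i) w z).symm
  | mul f g hf hg => simpa using (hg i z z).trans (hf _ z w)

theorem Surf.pathConnectedSpace [Nonempty ι] (h : ∀ i j, ∃ f, act a b f i = j) :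
    PathConnectedSpace (Surf a b) := by
  obtain ⟨i₀⟩ := ‹Nonempty ι›
  obtain ⟨z₀⟩ := PathConnectedSpace.nonempty (X := Piece)
  refine ⟨⟨Surf.mk a b (i₀, z₀)⟩, fun x y => ?_⟩
  obtain ⟨⟨i, z⟩, rfl⟩ := Surf.mk_surjective x
  obtain ⟨⟨j, w⟩, rfl⟩ := Surf.mk_surjective y
  obtain ⟨f, rfl⟩ := h i j
  exact Surf.joined_act f i z w

end Action

end Schori

/-! ### Combinatorics of cutting and regluing; the action of words on ends. -/

namespace Schori

instance finite_sheet (ℓ : ℕ) : Finite (Sheet ℓ) := by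
  induction ℓ with
  | zero => exact inferInstanceAs (Finite Unit)
  | succ ℓ ih => exact inferInstanceAs (Finite (Sheet ℓ × Fin 3))

/-- The copy number `i` of the piece `v`. -/
def Sheet.copy {ℓ : ℕ} (v : Sheet ℓ) (i : Fin 3) : Sheet (ℓ + 1) := (v, i)

/-- The piece of which `v` is a copy. -/
def Sheet.pred {ℓ : ℕ} (v : Sheet (ℓ + 1)) : Sheet ℓ := v.1

@[simp] theorem Sheet.pred_copy {ℓ : ℕ} (v : Sheet ℓ) (i : Fin 3) : (v.copy i).pred = v := rfl

@[simp] theorem Sheet.copy_inj {ℓ : ℕ} {v w : Sheet ℓ} {i j : Fin 3} :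
    v.copy i = w.copy j ↔ v = w ∧ i = j := Prod.mk_inj

theorem Sheet.exists_eq_copy {ℓ : ℕ} (v : Sheet (ℓ + 1)) : ∃ i, v = v.pred.copy i := ⟨v.2, rfl⟩

theorem baseSheet_succ (ℓ : ℕ) : baseSheet (ℓ + 1) = (baseSheet ℓ).copy 1 := rfl

section Regluing

variable (τ : Equiv.Perm (Fin 3)) (c : ∀ ℓ, Sheet ℓ)

open Classical in
theorem regluing_copy {ℓ : ℕ} (v : Sheet ℓ) (i : Fin 3) : regluing τ c (ℓ + 1) (v.copy i) =
    (regluing τ c ℓ v).copy ((if v = c ℓ then τ else 1) i) := rfl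

theorem regluing_copy_of_ne {ℓ : ℕ} {v : Sheet ℓ} (h : v ≠ c ℓ) (i : Fin 3) :
    regluing τ c (ℓ + 1) (v.copy i) = (regluing τ c ℓ v).copy i := by
  rw [regluing_copy, if_neg h]
  rfl

theorem regluing_copy_self (ℓ : ℕ) (i : Fin 3) :
    regluing τ c (ℓ + 1) ((c ℓ).copy i) = (regluing τ c ℓ (c ℓ)).copy (τ i) := by
  rw [regluing_copy, if_pos rfl]

theorem pred_regluing (ℓ : ℕ) (v : Sheet (ℓ + 1)) :
    (regluing τ c (ℓ + 1) v).pred = regluing τ c ℓ v.pred := rfl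

theorem regluing_copy_of_fixed {i : Fin 3} (hi : τ i = i) (ℓ : ℕ) (v : Sheet ℓ) :
    regluing τ c (ℓ + 1) (v.copy i) = (regluing τ c ℓ v).copy i := by
  by_cases h : v = c ℓ
  · rw [h, regluing_copy_self, hi]
  · exact regluing_copy_of_ne τ c h i

theorem iterate_regluing_copy {ℓ : ℕ} {v : Sheet ℓ} {n : ℕ}
    (h : ∀ j < n, (regluing τ c ℓ)^[j] v ≠ c ℓ) (i : Fin 3) :
    (regluing τ c (ℓ + 1))^[n] (v.copy i) = ((regluing τ c ℓ)^[n] v).copy i := by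
  induction n with
  | zero => rfl
  | succ n ih =>
    rw [Function.iterate_succ_apply', ih fun j hj => h j (hj.trans n.lt_succ_self),
      regluing_copy_of_ne τ c (h n n.lt_succ_self), Function.iterate_succ_apply']

theorem iterate_regluing_copy_of_fixed {i : Fin 3} (hi : τ i = i) {ℓ : ℕ} (v : Sheet ℓ) (n : ℕ) :
    (regluing τ c (ℓ + 1))^[n] (v.copy i) = ((regluing τ c ℓ)^[n] v).copy i := by
  induction n with
  | zero => rfl
  | succ n ih =>
    rw [Function.iterate_succ_apply', ih, regluing_copy_of_fixed τ c hi,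
      Function.iterate_succ_apply']

theorem pred_iterate_regluing {ℓ : ℕ} (n : ℕ) (v : Sheet (ℓ + 1)) :
    ((regluing τ c (ℓ + 1))^[n] v).pred = (regluing τ c ℓ)^[n] v.pred :=
  Function.Semiconj.iterate_right (f := Sheet.pred) (pred_regluing τ c ℓ) n v

/-- Going once around the cycle of `v` applies `τ` to the number of the copy, if the cycle contains
the cut. -/
theorem exists_iterate_regluing {ℓ : ℕ} {v : Sheet ℓ}
    (h : (regluing τ c ℓ).SameCycle v (c ℓ)) : ∃ k, (regluing τ c ℓ)^[k] v = v ∧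
      ∀ i, (regluing τ c (ℓ + 1))^[k] (v.copy i) = v.copy (τ i) := by
  set R := regluing τ c ℓ with hR
  have hper : v ∈ Function.periodicPts R := R.injective.mem_periodicPts v
  have hpos := Function.minimalPeriod_pos_of_mem_periodicPts hper
  obtain ⟨m, hm, hmc⟩ : ∃ m < Function.minimalPeriod R v, R^[m] v = c ℓ := by
    obtain ⟨m, -, hm⟩ := h.exists_pow_eq'
    refine ⟨m % Function.minimalPeriod R v, Nat.mod_lt _ hpos, ?_⟩
    rw [Function.iterate_mod_minimalPeriod_eq, Equiv.Perm.iterate_eq_pow, hm]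
  have huniq : ∀ j < Function.minimalPeriod R v, R^[j] v = c ℓ → j = m := fun j hj hjc =>
    Function.iterate_injOn_Iio_minimalPeriod hj hm (hjc.trans hmc.symm)
  -- Within one minimal period the cut is met only at time `m`, so `τ` is applied exactly once.
  refine ⟨Function.minimalPeriod R v, Function.iterate_minimalPeriod, fun i => ?_⟩
  obtain ⟨n, hn⟩ : ∃ n, Function.minimalPeriod R v = n + (m + 1) :=
    ⟨Function.minimalPeriod R v - (m + 1), by omega⟩
  have h0 : ∀ j < m, R^[j] v ≠ c ℓ := fun j hj hjc => by
    have := huniq j (hj.trans hm) hjc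
    omega
  have h1 : (regluing τ c (ℓ + 1))^[m + 1] (v.copy i) = (R^[m + 1] v).copy (τ i) := by
    rw [Function.iterate_succ_apply', iterate_regluing_copy τ c h0, Function.iterate_succ_apply',
      ← hR, hmc, regluing_copy_self]
  have h2 : R^[n] (R^[m + 1] v) = v := by
    rw [← Function.iterate_add_apply, ← hn, Function.iterate_minimalPeriod]
  have h3 : ∀ j < n, R^[j] (R^[m + 1] v) ≠ c ℓ := fun j hj hjc => by
    rw [← Function.iterate_add_apply] at hjc
    have := huniq (j + (m + 1)) (by omega) hjc
    omega
  rw [hn, Function.iterate_add_apply, h1, iterate_regluing_copy τ c h3, ← hR, h2]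

theorem not_sameCycle_of_pred {ℓ : ℕ} {v : Sheet (ℓ + 1)}
    (h : ¬ (regluing τ c ℓ).SameCycle (baseSheet ℓ) v.pred) :
    ¬ (regluing τ c (ℓ + 1)).SameCycle (baseSheet (ℓ + 1)) v := by
  intro h'
  obtain ⟨n, -, hn⟩ := h'.exists_pow_eq'
  refine h ⟨n, ?_⟩
  rw [← Equiv.Perm.iterate_eq_pow] at hn
  rw [zpow_natCast, ← Equiv.Perm.iterate_eq_pow, ← hn, pred_iterate_regluing]
  rfl

/-- A copy number fixed by `τ` never changes along the cycle, whereas the base piece has number 1.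
-/
theorem not_sameCycle_of_fixed {i : Fin 3} (hi : τ i = i) (hi1 : i ≠ 1) {ℓ : ℕ} (v : Sheet ℓ) :
    ¬ (regluing τ c (ℓ + 1)).SameCycle (baseSheet (ℓ + 1)) (v.copy i) := by
  intro h
  obtain ⟨n, -, hn⟩ := h.symm.exists_pow_eq'
  rw [← Equiv.Perm.iterate_eq_pow, iterate_regluing_copy_of_fixed τ c hi, baseSheet_succ,
    Sheet.copy_inj] at hn
  exact hi1 hn.2

theorem iterate_ne_cut (hc : ∀ ℓ, (regluing τ c ℓ).SameCycle (baseSheet ℓ) (c ℓ)) {ℓ : ℕ}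
    {v : Sheet ℓ} (h : ¬ (regluing τ c ℓ).SameCycle (baseSheet ℓ) v) (j : ℕ) :
    (regluing τ c ℓ)^[j] v ≠ c ℓ := by
  intro hj
  refine h ((hc ℓ).trans ?_)
  rw [← hj, Equiv.Perm.iterate_eq_pow]
  exact (Equiv.Perm.sameCycle_pow_right.2 (Equiv.Perm.SameCycle.refl _ _)).symm

end Regluing

/-- The ends of the tree of pieces: the pieces of the solenoid. -/
abbrev Ends : Type := InverseLimit Sheet fun _ => Sheet.pred

theorem Ends.pred_eq (v : Ends) (ℓ : ℕ) : (v.1 (ℓ + 1)).pred = v.1 ℓ := v.2 ℓ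

theorem continuous_pred (ℓ : ℕ) : Continuous (Sheet.pred (ℓ := ℓ)) := continuous_of_discreteTopology

instance : CompactSpace Ends :=
  InverseLimit.compactSpace (fun _ => inferInstance) (fun _ => inferInstance) continuous_pred

instance : T2Space Ends := InverseLimit.t2Space fun _ => inferInstance

/-- The end of the base pieces. -/
def baseEnd : Ends := ⟨baseSheet, fun _ => rfl⟩

instance : Nonempty Ends := ⟨baseEnd⟩

/-- All cuts lie on cycles of base pieces. Once the end has left these cycles, its cycle is never
cut again, so a return at level `ℓ` persists at higher levels; lower levels follow by projection. -/
theorem iterate_regluing_end (τ : Equiv.Perm (Fin 3)) (c : ∀ ℓ, Sheet ℓ)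
    (hc : ∀ ℓ, (regluing τ c ℓ).SameCycle (baseSheet ℓ) (c ℓ)) {ℓ k : ℕ} {v : Ends}
    (hn : ¬ (regluing τ c ℓ).SameCycle (baseSheet ℓ) (v.1 ℓ))
    (hk : (regluing τ c ℓ)^[k] (v.1 ℓ) = v.1 ℓ) (m : ℕ) :
    (regluing τ c m)^[k] (v.1 m) = v.1 m := by
  have up : ∀ m, ℓ ≤ m → ¬ (regluing τ c m).SameCycle (baseSheet m) (v.1 m) ∧
      (regluing τ c m)^[k] (v.1 m) = v.1 m := by
    intro m hm
    induction m, hm using Nat.le_induction with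
    | base => exact ⟨hn, hk⟩
    | succ m _ ih =>
      obtain ⟨i, hi⟩ := (v.1 (m + 1)).exists_eq_copy
      rw [v.pred_eq m] at hi
      refine ⟨not_sameCycle_of_pred τ c (by rw [v.pred_eq m]; exact ih.1), ?_⟩
      rw [hi, iterate_regluing_copy τ c fun j _ => iterate_ne_cut τ c hc ih.1 j, ih.2]
  have down : ∀ d, (regluing τ c (m + d))^[k] (v.1 (m + d)) = v.1 (m + d) →
      (regluing τ c m)^[k] (v.1 m) = v.1 m := by
    intro d
    induction d with
    | zero => exact id
    | succ d ih =>
      intro h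
      apply ih
      rw [← v.pred_eq (m + d), ← pred_iterate_regluing]
      exact congrArg Sheet.pred h
  exact down ℓ (up _ (Nat.le_add_left _ _)).2

variable (κ : Cuts)

/-- The permutation of the pieces of `X_ℓ` given by crossing the lifts of `C₀`. -/
noncomputable abbrev permC (ℓ : ℕ) : Equiv.Perm (Sheet ℓ) := regluing (Equiv.swap 0 1) κ.C ℓ

/-- The permutation of the pieces of `X_ℓ` given by crossing the lifts of `D₀`. -/
noncomputable abbrev permD (ℓ : ℕ) : Equiv.Perm (Sheet ℓ) := regluing (Equiv.swap 1 2) κ.D ℓ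

/-- The action of words in the two crossings on the pieces of `X_ℓ`. -/
noncomputable def word (ℓ : ℕ) : FreeGroup Bool →* Equiv.Perm (Sheet ℓ) :=
  act (permC κ ℓ) (permD κ ℓ)

theorem pred_word (ℓ : ℕ) (f : FreeGroup Bool) (v : Sheet (ℓ + 1)) :
    (word κ (ℓ + 1) f v).pred = word κ ℓ f v.pred :=
  act_map _ _ (fun v => pred_regluing _ _ ℓ v) (fun v => pred_regluing _ _ ℓ v) f v

theorem word_pow_true (ℓ k : ℕ) (v : Sheet ℓ) :
    word κ ℓ (FreeGroup.of true ^ k) v = (permC κ ℓ)^[k] v := by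
  rw [map_pow, word, act_true, Equiv.Perm.iterate_eq_pow]

theorem word_pow_false (ℓ k : ℕ) (v : Sheet ℓ) :
    word κ ℓ (FreeGroup.of false ^ k) v = (permD κ ℓ)^[k] v := by
  rw [map_pow, word, act_false, Equiv.Perm.iterate_eq_pow]

/-- The action of words on the ends. -/
noncomputable def endWord (f : FreeGroup Bool) (v : Ends) : Ends :=
  ⟨fun ℓ => word κ ℓ f (v.1 ℓ), fun ℓ => (pred_word κ ℓ f _).trans (congrArg _ (v.2 ℓ))⟩

theorem endWord_apply (f : FreeGroup Bool) (v : Ends) (ℓ : ℕ) :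
    (endWord κ f v).1 ℓ = word κ ℓ f (v.1 ℓ) := rfl

@[simp] theorem endWord_one (v : Ends) : endWord κ 1 v = v :=
  Subtype.ext (funext fun ℓ => by simp [endWord_apply])

theorem endWord_mul (f g : FreeGroup Bool) (v : Ends) :
    endWord κ (f * g) v = endWord κ f (endWord κ g v) :=
  Subtype.ext (funext fun ℓ => by simp [endWord_apply])

@[simp] theorem endWord_inv_self (f : FreeGroup Bool) (v : Ends) :
    endWord κ f⁻¹ (endWord κ f v) = v := by rw [← endWord_mul]; simp

@[simp] theorem endWord_self_inv (f : FreeGroup Bool) (v : Ends) :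
    endWord κ f (endWord κ f⁻¹ v) = v := by rw [← endWord_mul]; simp

theorem continuous_endWord (f : FreeGroup Bool) : Continuous (endWord κ f) :=
  InverseLimit.continuous_iff_level.2 fun ℓ =>
    continuous_of_discreteTopology.comp (InverseLimit.continuous_level ℓ)

/-- A word running around the handle `H_ℓ`. -/
theorem exists_word_C (ℓ : ℕ) : ∃ f, (∀ i, word κ (ℓ + 1) f ((baseSheet ℓ).copy i) =
    (baseSheet ℓ).copy (Equiv.swap 0 1 i)) ∧
      ∀ v : Ends, v.1 (ℓ + 1) = (baseSheet ℓ).copy 2 → endWord κ f v = v := by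
  obtain ⟨k, hk, hk'⟩ := exists_iterate_regluing (Equiv.swap 0 1) κ.C (κ.C_mem ℓ)
  refine ⟨FreeGroup.of true ^ k, fun i => by rw [word_pow_true, hk'], fun v hv => ?_⟩
  have h2 : Equiv.swap (0 : Fin 3) 1 2 = 2 := by decide
  refine Subtype.ext (funext fun m => ?_)
  rw [endWord_apply, word_pow_true]
  refine iterate_regluing_end _ _ κ.C_mem (ℓ := ℓ + 1) ?_ ?_ m
  · rw [hv]
    exact not_sameCycle_of_fixed _ _ h2 (by decide) _
  · rw [hv, hk', h2]

/-- A word running around the handle `F_ℓ`. -/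
theorem exists_word_D (ℓ : ℕ) : ∃ f, (∀ i, word κ (ℓ + 1) f ((baseSheet ℓ).copy i) =
    (baseSheet ℓ).copy (Equiv.swap 1 2 i)) ∧
      ∀ v : Ends, v.1 (ℓ + 1) = (baseSheet ℓ).copy 0 → endWord κ f v = v := by
  obtain ⟨k, hk, hk'⟩ := exists_iterate_regluing (Equiv.swap 1 2) κ.D (κ.D_mem ℓ)
  refine ⟨FreeGroup.of false ^ k, fun i => by rw [word_pow_false, hk'], fun v hv => ?_⟩
  have h0 : Equiv.swap (1 : Fin 3) 2 0 = 0 := by decide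
  refine Subtype.ext (funext fun m => ?_)
  rw [endWord_apply, word_pow_false]
  refine iterate_regluing_end _ _ κ.D_mem (ℓ := ℓ + 1) ?_ ?_ m
  · rw [hv]
    exact not_sameCycle_of_fixed _ _ h0 (by decide) _
  · rw [hv, hk', h0]

/-- By induction the piece is brought over the base piece; (0 1) or (1 2) then moves copy 0 or 2 to
copy 1. -/
theorem exists_word_base (ℓ : ℕ) (v : Sheet ℓ) : ∃ f, word κ ℓ f v = baseSheet ℓ := by
  induction ℓ with
  | zero => exact ⟨1, rfl⟩
  | succ ℓ ih =>
    obtain ⟨f, hf⟩ := ih v.pred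
    obtain ⟨i, hi⟩ := (word κ (ℓ + 1) f v).exists_eq_copy
    rw [pred_word, hf] at hi
    obtain ⟨p, hp, -⟩ := exists_word_C κ ℓ
    obtain ⟨q, hq, -⟩ := exists_word_D κ ℓ
    fin_cases i
    · exact ⟨p * f, by rw [map_mul, Equiv.Perm.mul_apply, hi, hp]; rfl⟩
    · exact ⟨f, hi⟩
    · exact ⟨q * f, by rw [map_mul, Equiv.Perm.mul_apply, hi, hq]; rfl⟩

theorem exists_word_eq (ℓ : ℕ) (v w : Sheet ℓ) : ∃ f, word κ ℓ f v = w := by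
  obtain ⟨f, hf⟩ := exists_word_base κ ℓ v
  obtain ⟨g, hg⟩ := exists_word_base κ ℓ w
  refine ⟨g⁻¹ * f, ?_⟩
  rw [map_mul, map_inv, Equiv.Perm.mul_apply, hf, Equiv.Perm.inv_eq_iff_eq, hg]

include κ in
theorem exists_end (ℓ : ℕ) (v : Sheet ℓ) : ∃ e : Ends, e.1 ℓ = v := by
  obtain ⟨f, hf⟩ := exists_word_eq κ ℓ (baseSheet ℓ) v
  exact ⟨endWord κ f baseEnd, hf⟩

/-- The permutations of the three copies of a piece induced by words fixing the piece do not
preserve a given copy up to conjugacy. -/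
theorem exists_words_not_normal (ℓ : ℕ) (v : Sheet (ℓ + 1)) : ∃ f g,
    word κ ℓ f v.pred = v.pred ∧ word κ ℓ g v.pred = v.pred ∧ word κ (ℓ + 1) f v = v ∧
      word κ (ℓ + 1) f (word κ (ℓ + 1) g v) ≠ word κ (ℓ + 1) g v := by
  obtain ⟨e, he⟩ := exists_word_base κ ℓ v.pred
  obtain ⟨i, hi⟩ := (word κ (ℓ + 1) e v).exists_eq_copy
  rw [pred_word, he] at hi
  obtain ⟨p, hp, -⟩ := exists_word_C κ ℓ
  obtain ⟨q, hq, -⟩ := exists_word_D κ ℓ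
  obtain ⟨f, g, σ, ρ, hf, hg, h1, h2⟩ : ∃ (f g : FreeGroup Bool) (σ ρ : Equiv.Perm (Fin 3)),
      (∀ i, word κ (ℓ + 1) f ((baseSheet ℓ).copy i) = (baseSheet ℓ).copy (σ i)) ∧
      (∀ i, word κ (ℓ + 1) g ((baseSheet ℓ).copy i) = (baseSheet ℓ).copy (ρ i)) ∧
      σ i = i ∧ σ (ρ i) ≠ ρ i := by
    -- For each copy `i`, a transposition fixing `i` but not its image under another one; for `i =
    -- 1` it is (0 2), obtained by conjugation.
    fin_cases i
    · exact ⟨q, p, _, _, hq, hp, by decide, by decide⟩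
    · refine ⟨p * q * p, p, Equiv.swap 0 1 * Equiv.swap 1 2 * Equiv.swap 0 1, _, fun i => ?_, hp,
        by decide, by decide⟩
      simp [hp, hq]
    · exact ⟨p, q, _, _, hp, hq, by decide, by decide⟩
  have hpred : ∀ {f : FreeGroup Bool} {σ : Equiv.Perm (Fin 3)},
      (∀ i, word κ (ℓ + 1) f ((baseSheet ℓ).copy i) = (baseSheet ℓ).copy (σ i)) →
      word κ ℓ (e⁻¹ * f * e) v.pred = v.pred := by
    intro f σ h
    rw [map_mul, map_mul, map_inv, Equiv.Perm.mul_apply, Equiv.Perm.mul_apply, he,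
      Equiv.Perm.inv_eq_iff_eq, he]
    have := congrArg Sheet.pred (h 0)
    rwa [pred_word] at this
  refine ⟨e⁻¹ * f * e, e⁻¹ * g * e, hpred hf, hpred hg, ?_, ?_⟩
  · rw [map_mul, map_mul, map_inv, Equiv.Perm.mul_apply, Equiv.Perm.mul_apply, hi,
      Equiv.Perm.inv_eq_iff_eq, hi, hf, h1]
  · intro h
    simp only [map_mul, map_inv, Equiv.Perm.mul_apply, hi, hg] at h
    rw [EmbeddingLike.apply_eq_iff_eq, ← Equiv.Perm.mul_apply (word κ (ℓ + 1) e), mul_inv_cancel,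
      Equiv.Perm.one_apply, hf, Sheet.copy_inj] at h
    exact h2 h.2

/-- No neighbourhood of an end is fixed by its stabilizer. -/
theorem exists_word_fixing_moving (v : Ends) (n : ℕ) :
    ∃ f, endWord κ f v = v ∧ ∃ w : Ends, w.1 n = v.1 n ∧ endWord κ f w ≠ w := by
  obtain ⟨e, he⟩ := exists_word_base κ n (v.1 n)
  obtain ⟨i, hi⟩ := ((endWord κ e v).1 (n + 1)).exists_eq_copy
  rw [(endWord κ e v).pred_eq, endWord_apply κ e v n, he] at hi
  obtain ⟨p, hp, hp'⟩ := exists_word_C κ n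
  obtain ⟨q, hq, hq'⟩ := exists_word_D κ n
  obtain ⟨f, j, k, hf, hjk, hj⟩ : ∃ f j k, endWord κ f (endWord κ e v) = endWord κ e v ∧ j ≠ k ∧
      word κ (n + 1) f ((baseSheet n).copy j) = (baseSheet n).copy k := by
    -- After moving to the base piece, `q` fixes all ends through copy 0 and `p` all ends through
    -- copy 2. An end through copy 1 is moved by `q` to copy 2, so the conjugate `q⁻¹ * p * q` fixes
    -- it, while sending copy 0 to copy 2.
    fin_cases i
    · exact ⟨q, 1, 2, hq' _ hi, by decide, hq 1⟩
    · refine ⟨q⁻¹ * p * q, 0, 2, ?_, by decide, ?_⟩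
      · rw [endWord_mul, endWord_mul, hp', endWord_inv_self]
        rw [endWord_apply, hi]
        exact hq 1
      · rw [map_mul, map_mul, map_inv, Equiv.Perm.mul_apply, Equiv.Perm.mul_apply,
          Equiv.Perm.inv_eq_iff_eq, hq, hq]
        exact hp 0
    · exact ⟨p, 0, 1, hp' _ hi, by decide, hp 0⟩
  obtain ⟨w, hw⟩ := exists_end κ (n + 1) ((baseSheet n).copy j)
  refine ⟨e⁻¹ * f * e, by rw [endWord_mul, endWord_mul, hf, endWord_inv_self],
    endWord κ e⁻¹ w, ?_, fun h => ?_⟩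
  · rw [endWord_apply, map_inv, Equiv.Perm.inv_eq_iff_eq, he, ← w.pred_eq, hw, Sheet.pred_copy]
  · rw [endWord_mul, endWord_mul, endWord_self_inv] at h
    have h := congrArg (endWord κ e) h
    rw [endWord_self_inv, endWord_self_inv] at h
    have h := congrArg (fun u : Ends => u.1 (n + 1)) h
    simp only [endWord_apply, hw, hj, Sheet.copy_inj, true_and] at h
    exact hjk h.symm

/-- There is an end near which every word fixing it is the identity. -/
theorem exists_generic_end : ∃ v : Ends, ∀ f, endWord κ f v = v →
    ∀ᶠ w in nhds v, endWord κ f w = w := by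
  -- `A f` is the complement of the frontier of the fixed set of `f`, hence open and dense; Baire's
  -- theorem applies to the compact Hausdorff space of ends.
  let A : FreeGroup Bool → Set Ends := fun f =>
    {w | endWord κ f w ≠ w} ∪ interior {w | endWord κ f w = w}
  have hc : ∀ f, IsClosed {w : Ends | endWord κ f w = w} := fun f =>
    isClosed_eq (continuous_endWord κ f) continuous_id
  have ho : ∀ f, IsOpen (A f) := fun f => (hc f).isOpen_compl.union isOpen_interior
  have hd : ∀ f, Dense (A f) := fun f => by
    have : A f = (frontier {w : Ends | endWord κ f w = w})ᶜ := by
      rw [(hc f).frontier_eq, Set.compl_sdiff, Set.union_comm]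
      rfl
    rw [this, ← interior_eq_empty_iff_dense_compl]
    exact interior_frontier (hc f)
  obtain ⟨v, hv⟩ := (dense_iInter_of_isOpen ho hd).nonempty
  refine ⟨v, fun f hf => ?_⟩
  rcases Set.mem_iInter.1 hv f with h | h
  · exact absurd hf h
  · exact mem_interior_iff_mem_nhds.1 h

end Schori

/-! ### Monodromy criterion for a covering not to be regular. -/

section Covering

open unitInterval

variable {E X : Type*} [TopologicalSpace E] [TopologicalSpace X] {p : E → X}

theorem IsCoveringMap.monodromy_mk_eq (cov : IsCoveringMap p) {b c : X} {γ : Path b c}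
    {Γ : C(I, E)} (hΓ : ∀ t, p (Γ t) = γ t) (e : p ⁻¹' {b}) (h0 : Γ 0 = e) :
    (cov.monodromy (Path.Homotopic.Quotient.mk γ) e : E) = Γ 1 := by
  have h : Γ = cov.liftPath γ e (γ.source.trans e.2.symm) :=
    (cov.eq_liftPath_iff' _).2 ⟨funext hΓ, h0⟩
  exact congrArg (fun Δ : C(I, E) => Δ 1) h.symm

/-- A covering is not regular at `x` if a loop in the base lifts to a loop at `x`, but not at
another point of the fibre that can be joined to `x`. -/
theorem IsCoveringMap.not_normal_range (cov : IsCoveringMap p) {x : E} {γ δ : Path (p x) (p x)}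
    {Γ Δ Γ' : C(I, E)} (hΓ : ∀ t, p (Γ t) = γ t) (hΓ0 : Γ 0 = x) (hΓ1 : Γ 1 = x)
    (hΔ : ∀ t, p (Δ t) = δ t) (hΔ0 : Δ 0 = x) (hΓ' : ∀ t, p (Γ' t) = γ t) (hΓ'0 : Γ' 0 = Δ 1)
    (hne : Γ' 1 ≠ Δ 1) :
    ¬ (FundamentalGroup.map (⟨p, cov.continuous⟩ : C(E, X)) x).range.Normal := by
  intro hN
  let g : FundamentalGroup X (p x) := FundamentalGroup.fromPath (Path.Homotopic.Quotient.mk γ)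
  let h : FundamentalGroup X (p x) := FundamentalGroup.fromPath (Path.Homotopic.Quotient.mk δ)
  let e : p ⁻¹' {p x} := ⟨x, rfl⟩
  have fix : ∀ k ∈ (FundamentalGroup.map (⟨p, cov.continuous⟩ : C(E, X)) x).range,
      cov.monodromyPerm (p x) k e = e := by
    rintro _ ⟨θ, rfl⟩
    exact cov.monodromy_map θ
  have hg : g ∈ (FundamentalGroup.map (⟨p, cov.continuous⟩ : C(E, X)) x).range := by
    refine ⟨FundamentalGroup.fromPath (Path.Homotopic.Quotient.mk ⟨Γ, hΓ0, hΓ1⟩), ?_⟩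
    change Path.Homotopic.Quotient.mk _ = Path.Homotopic.Quotient.mk γ
    congr 1
    ext t
    exact hΓ t
  -- Were the image normal, the conjugate by `h` would fix `x`, so `γ` would lift to a loop at the
  -- end point of `Δ`.
  have hconj := fix _ (hN.conj_mem g hg h⁻¹)
  rw [inv_inv, map_mul, map_mul, map_inv, Equiv.Perm.mul_apply, Equiv.Perm.mul_apply,
    Equiv.Perm.inv_eq_iff_eq] at hconj
  have hh : (cov.monodromyPerm (p x) h e : E) = Δ 1 := cov.monodromy_mk_eq hΔ e hΔ0
  have hgh : (cov.monodromyPerm (p x) g (cov.monodromyPerm (p x) h e) : E) = Γ' 1 :=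
    cov.monodromy_mk_eq hΓ' _ (hΓ'0.trans hh.symm)
  exact hne (by rw [← hgh, hconj, hh])

end Covering

/-! ### The surfaces `X_ℓ` form a presentation. -/

namespace Schori

open Topology unitInterval

variable (κ : Cuts)

/-- The point of `X_ℓ` given by a point of the piece `v`. -/
noncomputable def pt (ℓ : ℕ) (v : Sheet ℓ) (z : Piece) : Surface κ ℓ :=
  Surf.mk (permC κ ℓ) (permD κ ℓ) (v, z)

variable {κ}

theorem exists_eq_pt {ℓ : ℕ} (x : Surface κ ℓ) : ∃ v z, x = pt κ ℓ v z := by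
  obtain ⟨⟨v, z⟩, rfl⟩ := Surf.mk_surjective (a := permC κ ℓ) (b := permD κ ℓ) x
  exact ⟨v, z, rfl⟩

theorem pt_inj {ℓ : ℕ} {v w : Sheet ℓ} {z : Piece} : pt κ ℓ v z = pt κ ℓ w z ↔ v = w :=
  ⟨Surf.mk_index_inj, fun h => h ▸ rfl⟩

theorem bond_pt (ℓ : ℕ) (v : Sheet (ℓ + 1)) (z : Piece) :
    bond κ ℓ (pt κ (ℓ + 1) v z) = pt κ ℓ v.pred z := rfl

theorem bond_eq_map (ℓ : ℕ) : bond κ ℓ = Surf.map (a := permC κ (ℓ + 1)) (b := permD κ (ℓ + 1))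
    (a' := permC κ ℓ) (b' := permD κ ℓ) Sheet.pred (pred_regluing _ _ ℓ) (pred_regluing _ _ ℓ) :=
  rfl

theorem exists_of_bond_eq_pt {ℓ : ℕ} {x : Surface κ (ℓ + 1)} {v : Sheet ℓ} {z : Piece}
    (h : bond κ ℓ x = pt κ ℓ v z) : ∃ w : Sheet (ℓ + 1), w.pred = v ∧ x = pt κ (ℓ + 1) w z :=
  Surf.exists_of_map_eq (ha := pred_regluing _ _ ℓ) (hb := pred_regluing _ _ ℓ) h

theorem isCoveringMap_bond (ℓ : ℕ) : IsCoveringMap (bond κ ℓ) := by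
  rw [bond_eq_map]
  exact Surf.isCoveringMap_map

theorem card_bond_fiber (ℓ : ℕ) (y : Surface κ ℓ) : Nat.card (bond κ ℓ ⁻¹' {y}) = 3 := by
  obtain ⟨v, z, rfl⟩ := exists_eq_pt y
  rw [← Nat.card_fin 3]
  refine (Nat.card_eq_of_bijective (fun i : Fin 3 =>
    (⟨pt κ (ℓ + 1) (v.copy i) z, rfl⟩ : bond κ ℓ ⁻¹' {pt κ ℓ v z})) ⟨fun i j h => ?_, ?_⟩).symm
  · exact (Sheet.copy_inj.1 (pt_inj.1 (congrArg Subtype.val h))).2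
  · rintro ⟨x, hx⟩
    obtain ⟨w, rfl, rfl⟩ := exists_of_bond_eq_pt hx
    obtain ⟨i, hi⟩ := w.exists_eq_copy
    exact ⟨i, Subtype.ext (congrArg (fun w => pt κ (ℓ + 1) w z) hi.symm)⟩

variable (κ)

theorem isPresentation : IsPresentation 2 (Surface κ) (bond κ) where
  dim_pos := by norm_num
  compact ℓ := Surf.compactSpace (a := permC κ ℓ) (b := permD κ ℓ)
  connected ℓ := by
    have : Nonempty (Sheet ℓ) := ⟨baseSheet ℓ⟩
    have : PathConnectedSpace (Surface κ ℓ) :=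
      Surf.pathConnectedSpace (a := permC κ ℓ) (b := permD κ ℓ) (exists_word_eq κ ℓ)
    infer_instance
  hausdorff ℓ := Surf.t2Space (a := permC κ ℓ) (b := permD κ ℓ)
  manifold ℓ := Surf.nonempty_chartedSpace (a := permC κ ℓ) (b := permD κ ℓ)
  covering := isCoveringMap_bond
  degree ℓ := ⟨3, by norm_num, card_bond_fiber ℓ⟩

/-! ### The covering by the free group, which turns paths into words and words into paths. -/

section Words

instance : TopologicalSpace (FreeGroup Bool) := ⊥

instance : DiscreteTopology (FreeGroup Bool) := ⟨rfl⟩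

/-- The covering of the genus two surface with group the free group. -/
abbrev FreeSurf : Type :=
  Surf (Equiv.mulLeft (FreeGroup.of true)) (Equiv.mulLeft (FreeGroup.of false))

/-- The point of `FreeSurf` given by a point of the piece `f`. -/
def freePt (f : FreeGroup Bool) (z : Piece) : FreeSurf := Surf.mk _ _ (f, z)

theorem exists_eq_freePt (x : FreeSurf) : ∃ f z, x = freePt f z := by
  obtain ⟨⟨f, z⟩, rfl⟩ := Surf.mk_surjective x
  exact ⟨f, z, rfl⟩

theorem act_mulLeft (f h : FreeGroup Bool) :
    act (Equiv.mulLeft (FreeGroup.of true)) (Equiv.mulLeft (FreeGroup.of false)) f h = f * h := by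
  induction f using FreeGroup.induction_on generalizing h with
  | C1 => simp
  | of c => cases c <;> simp
  | inv_of c _ =>
    rw [map_inv, Equiv.Perm.inv_eq_iff_eq]
    cases c <;> simp
  | mul f g hf hg => rw [map_mul, Equiv.Perm.mul_apply, hg, hf, mul_assoc]

instance : PathConnectedSpace FreeSurf :=
  Surf.pathConnectedSpace fun f g => ⟨g * f⁻¹, by rw [act_mulLeft, inv_mul_cancel_right]⟩

theorem word_of_true_mul (ℓ : ℕ) (v : Sheet ℓ) (f : FreeGroup Bool) :
    word κ ℓ (Equiv.mulLeft (FreeGroup.of true) f) v = permC κ ℓ (word κ ℓ f v) := by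
  simp [word]

theorem word_of_false_mul (ℓ : ℕ) (v : Sheet ℓ) (f : FreeGroup Bool) :
    word κ ℓ (Equiv.mulLeft (FreeGroup.of false) f) v = permD κ ℓ (word κ ℓ f v) := by
  simp [word]

/-- The map to `X_ℓ` that sends the piece `1` to the piece `v`. -/
noncomputable def orbitMap (ℓ : ℕ) (v : Sheet ℓ) : FreeSurf → Surface κ ℓ :=
  Surf.map (a' := permC κ ℓ) (b' := permD κ ℓ) (fun f => word κ ℓ f v) (word_of_true_mul κ ℓ v)
    (word_of_false_mul κ ℓ v)

theorem orbitMap_freePt (ℓ : ℕ) (v : Sheet ℓ) (f : FreeGroup Bool) (z : Piece) :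
    orbitMap κ ℓ v (freePt f z) = pt κ ℓ (word κ ℓ f v) z := rfl

theorem continuous_orbitMap (ℓ : ℕ) (v : Sheet ℓ) : Continuous (orbitMap κ ℓ v) :=
  Surf.continuous_map

theorem isCoveringMap_orbitMap (ℓ : ℕ) (v : Sheet ℓ) : IsCoveringMap (orbitMap κ ℓ v) :=
  Surf.isCoveringMap_map

theorem bond_orbitMap (ℓ : ℕ) (v : Sheet (ℓ + 1)) (x : FreeSurf) :
    bond κ ℓ (orbitMap κ (ℓ + 1) v x) = orbitMap κ ℓ v.pred x := by
  obtain ⟨f, z, rfl⟩ := exists_eq_freePt x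
  rw [orbitMap_freePt, orbitMap_freePt, bond_pt, pred_word]

/-- A path in `FreeSurf` from piece `1` to piece `f` maps to compatible paths in both surfaces, so
the failure of normality for words becomes one for loops. -/
theorem not_normal_range_bond (ℓ : ℕ) (x : Surface κ (ℓ + 1)) : ¬ (FundamentalGroup.map
      (⟨bond κ ℓ, continuous_bond κ ℓ⟩ : C(Surface κ (ℓ + 1), Surface κ ℓ)) x).range.Normal := by
  obtain ⟨v, z, rfl⟩ := exists_eq_pt x
  obtain ⟨f, g, hf, hg, hfv, hne⟩ := exists_words_not_normal κ ℓ v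
  let P : ∀ f, Path (freePt 1 z) (freePt f z) := fun f => PathConnectedSpace.somePath _ _
  let lift : FreeGroup Bool → Sheet (ℓ + 1) → C(I, Surface κ (ℓ + 1)) := fun f v =>
    ⟨fun t => orbitMap κ (ℓ + 1) v (P f t), (continuous_orbitMap κ _ v).comp (P f).continuous⟩
  have lift0 : ∀ f v, lift f v 0 = pt κ (ℓ + 1) v z := fun f v => by
    simp [lift, orbitMap_freePt]
  have lift1 : ∀ f v, lift f v 1 = pt κ (ℓ + 1) (word κ (ℓ + 1) f v) z := fun f v => by
    simp [lift, orbitMap_freePt]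
  let γ : ∀ f, word κ ℓ f v.pred = v.pred →
      Path (bond κ ℓ (pt κ (ℓ + 1) v z)) (bond κ ℓ (pt κ (ℓ + 1) v z)) := fun f hf =>
    ⟨⟨fun t => orbitMap κ ℓ v.pred (P f t), (continuous_orbitMap κ _ _).comp (P f).continuous⟩,
      by simp [orbitMap_freePt, bond_pt], by simp [orbitMap_freePt, bond_pt, hf]⟩
  refine (isCoveringMap_bond ℓ).not_normal_range (γ := γ f hf) (δ := γ g hg) (Γ := lift f v)
    (Δ := lift g v) (Γ' := lift f (word κ (ℓ + 1) g v)) (fun t => bond_orbitMap κ ℓ v _)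
    (lift0 f v) ?_ (fun t => bond_orbitMap κ ℓ v _) (lift0 g v) (fun t => ?_) ?_ ?_
  · rw [lift1, hfv]
  · refine (bond_orbitMap κ ℓ _ _).trans ?_
    rw [pred_word, hg]
    rfl
  · rw [lift0, lift1]
  · rw [lift1, lift1, ne_eq, pt_inj]
    exact hne

end Words

/-! ### Leaves of the solenoid and the two statements on germinal holonomy. -/

section Solenoid

/-- The point of the solenoid given by a point of the piece `v`. -/
noncomputable def endPt (v : Ends) (z : Piece) : Solenoid κ :=
  ⟨fun ℓ => pt κ ℓ (v.1 ℓ) z, fun ℓ => by rw [bond_pt, v.pred_eq]⟩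

variable {κ}

theorem endPt_injective (z : Piece) : Function.Injective fun v => endPt κ v z := fun _ _ h =>
  Subtype.ext (funext fun ℓ => pt_inj.1 (congrArg (fun s : Solenoid κ => s.1 ℓ) h))

theorem continuous_endPt (z : Piece) : Continuous fun v => endPt κ v z :=
  InverseLimit.continuous_iff_level.2 fun ℓ =>
    (continuous_of_discreteTopology (f := fun v : Sheet ℓ => pt κ ℓ v z)).comp
      (InverseLimit.continuous_level ℓ)

theorem isEmbedding_endPt (z : Piece) : IsEmbedding fun v => endPt κ v z := by
  have := InverseLimit.t2Space (p := bond κ) (isPresentation κ).hausdorff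
  exact ((continuous_endPt z).isClosedEmbedding (endPt_injective z)).isEmbedding

/-- Within a fibre the coordinate `z` stays the same at all levels, and the pieces, being unique,
are compatible. -/
theorem exists_eq_endPt_of_level_zero {s : Solenoid κ} {z : Piece} {v₀ : Sheet 0}
    (h : s.1 0 = pt κ 0 v₀ z) : ∃ v, s = endPt κ v z := by
  have hex : ∀ ℓ, ∃ v : Sheet ℓ, s.1 ℓ = pt κ ℓ v z := by
    intro ℓ
    induction ℓ with
    | zero => exact ⟨v₀, h⟩
    | succ ℓ ih =>
      obtain ⟨v, hv⟩ := ih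
      rw [← s.2 ℓ] at hv
      obtain ⟨w, -, hw⟩ := exists_of_bond_eq_pt hv
      exact ⟨w, hw⟩
  choose v hv using hex
  have hpred : ∀ ℓ, (v (ℓ + 1)).pred = v ℓ := fun ℓ => by
    rw [← pt_inj (κ := κ) (z := z), ← bond_pt, ← hv, ← hv, s.2]
  exact ⟨⟨v, hpred⟩, Subtype.ext (funext hv)⟩

theorem exists_eq_endPt (s : Solenoid κ) : ∃ v z, s = endPt κ v z := by
  obtain ⟨v₀, z, h⟩ := exists_eq_pt (s.1 0)
  obtain ⟨v, hv⟩ := exists_eq_endPt_of_level_zero h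
  exact ⟨v, z, hv⟩

variable (κ)

/-- The transverse sections given by the defining presentation of the Schori solenoid. -/
def stdSection (b : Surface κ 0) : TransverseSection.{0} (Solenoid κ) where
  dim := 2
  M := Surface κ
  bond := bond κ
  isPresentation := isPresentation κ
  homeo := Homeomorph.refl _
  base := b

variable {κ} {b : Surface κ 0}

theorem stdSection_proj_endPt_eq (v w : Ends) (z : Piece) :
    (stdSection κ b).proj (endPt κ v z) = (stdSection κ b).proj (endPt κ w z) := rfl

/-- The map to the leaf of `v` that sends the piece `1` to the piece `v`. -/
noncomputable def leafMap (v : Ends) (x : FreeSurf) : Solenoid κ :=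
  ⟨fun ℓ => orbitMap κ ℓ (v.1 ℓ) x, fun ℓ => by rw [bond_orbitMap, v.pred_eq]⟩

theorem continuous_leafMap (v : Ends) : Continuous (leafMap (κ := κ) v) :=
  InverseLimit.continuous_iff_level.2 fun ℓ => continuous_orbitMap κ ℓ _

theorem leafMap_freePt (v : Ends) (f : FreeGroup Bool) (z : Piece) :
    leafMap v (freePt f z) = endPt κ (endWord κ f v) z := rfl

/-- The lifts along leaves of a path in the genus two surface are given by a word. -/
theorem exists_endWord_of_path {Γ : C(I, Solenoid κ)} {v w : Ends} {z z' : Piece}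
    (h0 : Γ 0 = endPt κ v z) (h1 : Γ 1 = endPt κ w z') : ∃ f, endWord κ f v = w ∧
      ∀ u, ∃ Δ : C(I, Solenoid κ), (∀ t, (stdSection κ b).proj (Δ t) = (stdSection κ b).proj (Γ t)) ∧
        Δ 0 = endPt κ u z ∧ Δ 1 = endPt κ (endWord κ f u) z' := by
  let γ : C(I, Surface κ 0) :=
    ⟨fun t => (stdSection κ b).proj (Γ t), (stdSection κ b).continuous_proj.comp Γ.continuous⟩
  -- The projected path is lifted to `FreeSurf`; the index of its final piece is the word, and
  -- composing this one lift with `leafMap u` serves all ends `u` at once.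
  obtain ⟨P, hP, hP0⟩ := (isCoveringMap_orbitMap κ 0 (baseSheet 0)).exists_path_lifts γ
    (freePt 1 z) (congrArg (fun s : Solenoid κ => s.1 0) h0)
  have hP : ∀ t, orbitMap κ 0 (baseSheet 0) (P t) = (stdSection κ b).proj (Γ t) := congr_fun hP
  obtain ⟨f, hf⟩ : ∃ f, P 1 = freePt f z' := by
    have h := hP 1
    rw [h1] at h
    obtain ⟨f, -, hf⟩ := Surf.exists_of_map_eq h
    exact ⟨f, hf⟩
  let lift : Ends → C(I, Solenoid κ) := fun u =>
    ⟨fun t => leafMap u (P t), (continuous_leafMap u).comp P.continuous⟩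
  have lift0 : ∀ u, lift u 0 = endPt κ u z := fun u => by
    simp only [lift, ContinuousMap.coe_mk, hP0, leafMap_freePt, endWord_one]
  have lift1 : ∀ u, lift u 1 = endPt κ (endWord κ f u) z' := fun u => by
    simp only [lift, ContinuousMap.coe_mk, hf, leafMap_freePt]
  have hlift : ∀ u t, (stdSection κ b).proj (lift u t) = (stdSection κ b).proj (Γ t) :=
    fun u t => hP t
  refine ⟨f, endPt_injective (κ := κ) z' ?_, fun u => ⟨lift u, hlift u, lift0 u, lift1 u⟩⟩
  have := (stdSection κ b).eq_of_lift (lift v).continuous Γ.continuous (hlift v) 0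
    (by rw [lift0, h0])
  change endPt κ (endWord κ f v) z' = endPt κ w z'
  rw [← h1, ← lift1, this]

/-- Every word is realized by paths in the leaves. -/
theorem exists_path_of_endWord (f : FreeGroup Bool) (z : Piece) :
    ∃ Γ : Ends → C(I, Solenoid κ), (∀ u v t, (stdSection κ b).proj (Γ u t) =
      (stdSection κ b).proj (Γ v t)) ∧
      ∀ u, Γ u 0 = endPt κ u z ∧ Γ u 1 = endPt κ (endWord κ f u) z := by
  let P : Path (freePt 1 z) (freePt f z) := PathConnectedSpace.somePath _ _
  refine ⟨fun u => ⟨fun t => leafMap u (P t), (continuous_leafMap u).comp P.continuous⟩,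
    fun u v t => rfl, fun u => ⟨?_, ?_⟩⟩
  · simp [leafMap_freePt]
  · simp [leafMap_freePt]

/-- Genericity passes along the orbit: a word fixing `g v` is conjugated by `g` to a word fixing
`v`. -/
theorem eventually_endWord_of_generic {v : Ends}
    (hv : ∀ f, endWord κ f v = v → ∀ᶠ w in 𝓝 v, endWord κ f w = w) (g f : FreeGroup Bool)
    (h : endWord κ f (endWord κ g v) = endWord κ g v) :
    ∀ᶠ w in 𝓝 (endWord κ g v), endWord κ f w = w := by
  have h1 := hv (g⁻¹ * f * g) (by rw [endWord_mul, endWord_mul, h, endWord_inv_self])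
  have h2 : Filter.Tendsto (endWord κ g⁻¹) (𝓝 (endWord κ g v)) (𝓝 v) := by
    have := (continuous_endWord κ g⁻¹).tendsto (endWord κ g v)
    rwa [endWord_inv_self] at this
  filter_upwards [h2.eventually h1] with w hw
  rw [endWord_mul, endWord_mul, endWord_self_inv] at hw
  have := congrArg (endWord κ g) hw
  rwa [endWord_self_inv, endWord_self_inv] at this

theorem exists_germTrivial_leaf (κ : Cuts) : ∃ x : Solenoid κ,
    ∀ (V : TransverseSection.{u} (Solenoid κ)) (y : V.carrier),
      (y : Solenoid κ) ∈ pathComponent x → V.GermTrivial y := by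
  obtain ⟨v, hv⟩ := exists_generic_end κ
  obtain ⟨z₀⟩ := PathConnectedSpace.nonempty (X := Piece)
  refine ⟨endPt κ v z₀, fun V y hy => V.germTrivial_of_loopLifts y fun Γ h0 h1 => ?_⟩
  obtain ⟨η⟩ := hy
  obtain ⟨u, z, hu⟩ := exists_eq_endPt y.1
  obtain ⟨g, hg, -⟩ := exists_endWord_of_path (b := pt κ 0 (baseSheet 0) z₀)
    (Γ := η.toContinuousMap) η.source (η.target.trans hu)
  subst hg
  obtain ⟨f, hf, hlift⟩ := exists_endWord_of_path (b := pt κ 0 (baseSheet 0) z₀) (h0.trans hu)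
    (h1.trans hu)
  have hev := eventually_endWord_of_generic hv g f hf
  -- Being fixed near an end is turned into a condition on a neighbourhood in the solenoid, as the
  -- comparison of sections requires.
  rw [(isEmbedding_endPt (κ := κ) z).isInducing.nhds_eq_comap, Filter.eventually_comap] at hev
  rw [← hu] at hev
  obtain ⟨N, hN, h⟩ :=
    (stdSection κ (pt κ 0 (baseSheet 0) z₀)).exists_nhds_loopLifts V y.1 hev
  refine ⟨N, hN, fun z' hz' hb => ?_⟩
  obtain ⟨s, hs, hproj, hs'⟩ := h z' hz' (hb.trans (Eq.symm y.2))
  refine hs' Γ h0 h1 ?_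
  rw [hu] at hproj
  obtain ⟨w, rfl⟩ := exists_eq_endPt_of_level_zero (v₀ := baseSheet 0) hproj
  obtain ⟨Δ, hΔ, hΔ0, hΔ1⟩ := hlift w
  exact ⟨Δ, hΔ, hΔ0, by rw [hΔ1, hs w rfl]⟩

/-- Local triviality would carry over to the standard section, where every loop at `x` would then
lift to a loop at each nearby point. A word fixing the end of `x` and moving a nearby end
contradicts this. -/
theorem not_germLocallyTrivial (V : TransverseSection.{u} (Solenoid κ)) (x : V.carrier) :
    ¬ V.GermLocallyTrivial x := by
  intro hx
  obtain ⟨U, hU, hUl⟩ := V.exists_nhds_of_germLocallyTrivial hx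
  obtain ⟨u, z, hu⟩ := exists_eq_endPt x.1
  obtain ⟨N, hN, hNl⟩ := V.exists_nhds_loopLifts (stdSection κ (pt κ 0 (baseSheet 0) z)) x.1 hU
  rw [hu] at hN
  obtain ⟨n, hn⟩ := InverseLimit.exists_cylinder_subset (fun _ => inferInstance)
    (fun _ => inferInstance) continuous_pred ((continuous_endPt (κ := κ) z).continuousAt hN)
  obtain ⟨f, hf, w, hw, hne⟩ := exists_word_fixing_moving κ u n
  obtain ⟨Γ, hΓ, hΓe⟩ := exists_path_of_endWord (b := pt κ 0 (baseSheet 0) z) f z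
  obtain ⟨s, hsU, hs, hl⟩ := hNl (endPt κ w z) (hn w hw)
    (by rw [hu]; exact stdSection_proj_endPt_eq _ _ _)
  have h0 : Γ u 0 = x.1 := by rw [(hΓe u).1, hu]
  have h1 : Γ u 1 = x.1 := by rw [(hΓe u).2, hf, hu]
  obtain ⟨Δ, hΔ, hΔ0, hΔ1⟩ := hl (Γ u) h0 h1 (hUl s hsU (hs.trans x.2) (Γ u) h0 h1)
  have := (stdSection κ _).eq_of_lift Δ.continuous (Γ w).continuous
    (fun t => (hΔ t).trans (hΓ u w t)) 0 (by rw [hΔ0, (hΓe w).1])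
  refine hne (endPt_injective (κ := κ) z ?_)
  change endPt κ (endWord κ f w) z = endPt κ w z
  rw [← (hΓe w).2, ← this, hΔ1]

end Solenoid

end Schori

theorem mainTheorem4 (κ : Schori.Cuts) :
    -- the bonding maps are non-regular 3-fold coverings of closed connected surfaces
    IsPresentation 2 (Schori.Surface κ) (Schori.bond κ) ∧
    (∀ ℓ y, Nat.card (Schori.bond κ ℓ ⁻¹' {y}) = 3) ∧
    (∀ ℓ x, ¬ (FundamentalGroup.map
      (⟨Schori.bond κ ℓ, Schori.continuous_bond κ ℓ⟩ :
        C(Schori.Surface κ (ℓ + 1), Schori.Surface κ ℓ)) x).range.Normal) ∧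
    -- there is a leaf with trivial germinal holonomy
    (∃ x : Schori.Solenoid κ, ∀ (V : TransverseSection.{u} (Schori.Solenoid κ)) (y : V.carrier),
      (y : Schori.Solenoid κ) ∈ pathComponent x → V.GermTrivial y) ∧
    -- for every section and every point, the germinal holonomy is not locally trivial
    (∀ (V : TransverseSection.{u} (Schori.Solenoid κ)) (x : V.carrier),
      ¬ V.GermLocallyTrivial x) := by
  exact ⟨Schori.isPresentation κ, Schori.card_bond_fiber, Schori.not_normal_range_bond κ,
    Schori.exists_germTrivial_leaf κ, Schori.not_germLocallyTrivial⟩
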